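/- **Theorem 2.1 (Global existence for the parabolic problem).** Let $H$ be a real Hilbert space with norm $|\cdot|$, and let $A$ be a nonnegative self-adjoint (possibly unbounded) linear operator on $H$ with dense domain $D(A)$. Let $b:[0,+\infty)\to(0,+\infty)$ be continuous, let $m:[0,+\infty)\to[0,+\infty)$ be locally Lipschitz continuous, and let $u_0\in D(A)$. For $\alpha\ge 0$ let $A^\alpha$, with domain $D(A^\alpha)$ equipped with the graph norm, denote the usual power of $A$. Then the problem $$b(t)u'(t)+m\big(|A^{1/2}u(t)|^2\big)Au(t)=0\quad(t\ge 0),\qquad u(0)=u_0,$$ has a unique global solution $$u\in C^1\big([0,+\infty);H\big)\cap C^0\big([0,+\infty);D(A)\big).$$ If in addition $m(|A^{1/2}u_0|^2)Au_0\neq 0$, then $u'(0)\ne 0$, the solution is non-stationary (that is, not constant in time), and $u\in C^1\big((0,+\infty);D(A^\alpha)\big)$ for every $\alpha\ge 0$. -/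

import Mathlib

open Set

noncomputable section

namespace Kirchhoff

variable {H : Type*} [NormedAddCommGroup H] [InnerProductSpace ℝ H]

/-- `T` is the bounded everywhere defined inverse `(I + A)⁻¹` of the unbounded operator `I + A`. -/
def IsResolvent (A : H →ₗ.[ℝ] H) (T : H →L[ℝ] H) : Prop :=
  ∀ x y : H, T x = y ↔ ∃ hy : y ∈ A.domain, y + A ⟨y, hy⟩ = x

open Classical in
/-- The resolvent `(I + A)⁻¹`. It exists (and is unique) whenever `A` is self-adjoint and
nonnegative; the value `0` is used only when it does not exist. -/
def resolvent (A : H →ₗ.[ℝ] H) : H →L[ℝ] H :=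
  if h : ∃ T : H →L[ℝ] H, IsResolvent A T then h.choose else 0

/-- The power `P ^ α`, `α ≥ 0`, of a bounded self-adjoint operator with `0 ≤ P ≤ I`, through the
binomial series of `(I - (I - P)) ^ α`. The series converges absolutely in operator norm, since
`‖I - P‖ ≤ 1` and the sum of `|α choose k|` over `k` is finite for every real `α ≥ 0`. -/
def contractionPow (P : H →L[ℝ] H) (α : ℝ) : H →L[ℝ] H :=
  ∑' k : ℕ, ((-1 : ℝ) ^ k * Ring.choose α k) • (1 - P) ^ k

/-- The power `A ^ α`, `α ≥ 0`, of a nonnegative self-adjoint unbounded operator `A`.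
With `T = (I + A)⁻¹`, so that `0 ≤ T ≤ I` and `A = (I - T) T⁻¹`, it is the operator
`A ^ α = (I - T) ^ α (T ^ α)⁻¹` with domain `D(A ^ α)` the range of `T ^ α`.
In spectral terms: `T ^ α` is multiplication by `(1 + lam) ^ (-α)` and `(I - T) ^ α` is
multiplication by `(lam / (1 + lam)) ^ α`, hence `A ^ α` is multiplication by `lam ^ α`
on the set of all `x` such that `(1 + lam) ^ α x` is square integrable. -/
def pow (A : H →ₗ.[ℝ] H) (α : ℝ) : H →ₗ.[ℝ] H :=
  (contractionPow (1 - resolvent A) α).toLinearMap.compPMap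
    ((contractionPow (resolvent A) α).toLinearMap.toPMap ⊤).inverse

open Classical in
/-- The value `B x` for `x ∈ D(B)` (and `0` outside `D(B)`, where it is never used). -/
def val (B : H →ₗ.[ℝ] H) (x : H) : H :=
  if h : x ∈ B.domain then B ⟨x, h⟩ else 0

/-- The nonlocal coefficient `m(|A^{1/2} x|²)`. -/
def coeff (A : H →ₗ.[ℝ] H) (m : ℝ → ℝ) (x : H) : ℝ :=
  m (‖val (pow A (1 / 2)) x‖ ^ 2)

/-- `u ∈ C^k(S; D(B))`, where `D(B)` carries the graph norm: the domain is identified with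
the graph of `B`, a subspace of `H × H`, through `x ↦ (x, B x)`. In particular `u t ∈ D(B)` for
every `t ∈ S`. -/
def ContDiffInDomain (k : ℕ) (B : H →ₗ.[ℝ] H) (S : Set ℝ) (u : ℝ → H) : Prop :=
  ∃ w : ℝ → B.graph, ContDiffOn ℝ k w S ∧ ∀ t ∈ S, (w t : H × H).1 = u t

/-- `u` (restricted to `[0, ∞)`) is a global solution, in the class
`C¹([0,∞); H) ∩ C⁰([0,∞); D(A))`, of
`b(t) u'(t) + m(|A^{1/2} u(t)|²) A u(t) = 0`, `u(0) = u₀`. -/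
structure IsGlobalSolution (A : H →ₗ.[ℝ] H) (b m : ℝ → ℝ) (u₀ : H) (u : ℝ → H) : Prop where
  contDiff : ContDiffOn ℝ 1 u (Ici 0)
  contDomain : ContDiffInDomain 0 A (Ici 0) u
  equation : ∀ t ∈ Ici (0 : ℝ),
    b t • derivWithin u (Ici 0) t + coeff A m (u t) • val A (u t) = 0
  initial : u 0 = u₀

end Kirchhoff

end

/-! The solution is an orbit of the linear semigroup run at a variable speed: `u t = exp (-φ(t) A)
u₀`, where `φ' = F(φ) / b(t)`, `φ(0) = 0` and `F(s) = m(|A^{1/2} exp (-s A) u₀|²)`. The evolution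
equation thus becomes a scalar ODE with separated variables. Since `u₀ ∈ D(A)`, the energy `|A^{1/2}
exp (-s A) u₀|²` is bounded and Lipschitz in `s ≥ 0` (`abs_energy_sub_le`), hence so is `F`, and `φ`
exists globally (`exists_global_time_change`).

Uniqueness is a Gronwall estimate for `‖u - v‖²`: the unbounded part of the difference has a good
sign because `A` is monotone, and only the difference of the two coefficients remains
(`inner_velocity_sub_le`). If `F(0) > 0`, then `φ > 0` at positive times, and the smoothing effect
of `exp (-s A)`, `s > 0`, puts `u` in every `D(A^α)`.

The spectral theory is carried by the bounded operator `T = (I + A)⁻¹`, for which `0 ≤ T ≤ I`. A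
continuous functional calculus on `[0, 1]` follows from one fact: `p(T) ≥ 0` when the polynomial `p`
is nonnegative on `[0, 1]` (`aeval_nonneg`). In the variable `x` of `T`, the operator `A` is `(1 -
x) / x`, its powers are quotients of powers of `1 - x` and `x`, and `exp (-s A)` is `exp (-s (1 - x)
/ x)`, continuous up to `x = 0` for `s > 0`. -/

namespace Kirchhoff

/-! ### The resolvent of a nonnegative self-adjoint operator. -/

section Resolvent

variable {H : Type*} [NormedAddCommGroup H] [InnerProductSpace ℝ H]

theorem IsResolvent.apply_mem {A : H →ₗ.[ℝ] H} {T : H →L[ℝ] H} (h : IsResolvent A T) (x : H) :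
    T x ∈ A.domain := ((h x (T x)).1 rfl).1

theorem IsResolvent.map_apply {A : H →ₗ.[ℝ] H} {T : H →L[ℝ] H} (h : IsResolvent A T) (x : H)
    (hx : T x ∈ A.domain) : A ⟨T x, hx⟩ = x - T x := by
  obtain ⟨_, h2⟩ := (h x (T x)).1 rfl
  exact eq_sub_of_add_eq' h2

theorem IsResolvent.val_apply {A : H →ₗ.[ℝ] H} {T : H →L[ℝ] H} (h : IsResolvent A T) (x : H) :
    val A (T x) = x - T x := by
  rw [val, dif_pos (h.apply_mem x), h.map_apply]

theorem IsResolvent.exists_eq {A : H →ₗ.[ℝ] H} {T : H →L[ℝ] H} (h : IsResolvent A T) {y : H}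
    (hy : y ∈ A.domain) : ∃ x, T x = y := ⟨_, (h _ y).2 ⟨hy, rfl⟩⟩

theorem IsResolvent.injective {A : H →ₗ.[ℝ] H} {T : H →L[ℝ] H} (h : IsResolvent A T) :
    Function.Injective T := by
  intro x x' hxx
  obtain ⟨h1, h2⟩ := (h x (T x)).1 rfl
  obtain ⟨h3, h4⟩ := (h x' (T x)).1 hxx.symm
  exact h2.symm.trans h4

theorem IsResolvent.denseRange {A : H →ₗ.[ℝ] H} {T : H →L[ℝ] H} (h : IsResolvent A T)
    (hA : Dense (A.domain : Set H)) : DenseRange T :=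
  hA.mono fun _ hy ↦ h.exists_eq hy

theorem isFormalAdjoint_self [CompleteSpace H] {A : H →ₗ.[ℝ] H} (hA : IsSelfAdjoint A)
    (x y : A.domain) : inner ℝ (A x) (y : H) = inner ℝ (x : H) (A y) := by
  have h := LinearPMap.adjoint_isFormalAdjoint (T := A) hA.dense_domain
  rw [LinearPMap.isSelfAdjoint_def.mp hA] at h
  exact h x y

theorem sq_norm_add_sq_norm_le {A : H →ₗ.[ℝ] H}
    (hA_nonneg : ∀ x : A.domain, 0 ≤ inner ℝ (A x) (x : H)) (x : A.domain) :
    ‖(x : H)‖ ^ 2 + ‖A x‖ ^ 2 ≤ ‖(x : H) + A x‖ ^ 2 := by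
  have := hA_nonneg x
  rw [real_inner_comm] at this
  rw [norm_add_sq_real]
  linarith

/-- On the closed graph of `A`, the map `(x, A x) ↦ x + A x` is bounded below, so its range is
closed. A vector `z` orthogonal to the range lies in `D(A*) = D(A)` with `A z = -z`, and
nonnegativity forces `z = 0`. -/
theorem exists_add_eq [CompleteSpace H] {A : H →ₗ.[ℝ] H} (hA : IsSelfAdjoint A)
    (hA_nonneg : ∀ x : A.domain, 0 ≤ inner ℝ (A x) (x : H)) (y : H) :
    ∃ x : A.domain, (x : H) + A x = y := by
  let L : A.graph →L[ℝ] H :=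
    (ContinuousLinearMap.fst ℝ H H + ContinuousLinearMap.snd ℝ H H).comp A.graph.subtypeL
  have hL (g : A.graph) : ∃ x : A.domain, (g : H × H) = ((x : H), A x) ∧ L g = (x : H) + A x := by
    obtain ⟨⟨a, b⟩, hg⟩ := g
    obtain ⟨x, rfl, rfl⟩ := (LinearPMap.mem_graph_iff A).1 hg
    exact ⟨x, rfl, rfl⟩
  have : CompleteSpace A.graph := hA.isClosed.completeSpace_coe
  have hanti : AntilipschitzWith 1 L := by
    refine AddMonoidHomClass.antilipschitz_of_bound L fun g ↦ ?_
    obtain ⟨x, h1, h2⟩ := hL g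
    have h3 := sq_norm_add_sq_norm_le hA_nonneg x
    rw [h2, NNReal.coe_one, one_mul, Submodule.coe_norm, h1, Prod.norm_def]
    refine max_le ?_ ?_ <;> refine le_of_sq_le_sq ?_ (norm_nonneg _) <;>
      nlinarith [sq_nonneg ‖(x : H)‖, sq_nonneg ‖A x‖]
  have hclosed : IsClosed (L.range : Set H) := by
    have h := hanti.isClosed_range L.uniformContinuous
    rwa [LinearMap.coe_range]
  have : CompleteSpace L.range := hclosed.completeSpace_coe
  have htop : L.range = ⊤ := by
    rw [← Submodule.orthogonal_eq_bot_iff, Submodule.eq_bot_iff]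
    intro z hz
    rw [Submodule.mem_orthogonal] at hz
    have hz' (x : A.domain) : inner ℝ (-z) (x : H) = inner ℝ z (A x) := by
      have := hz (L ⟨((x : H), A x), (LinearPMap.mem_graph_iff A).2 ⟨x, rfl, rfl⟩⟩) ⟨_, rfl⟩
      change inner ℝ ((x : H) + A x) z = 0 at this
      rw [real_inner_comm, inner_add_right] at this
      rw [inner_neg_left]
      linarith
    have hAz : A.adjoint = A := LinearPMap.isSelfAdjoint_def.mp hA
    have hzd : z ∈ A.adjoint.domain := LinearPMap.mem_adjoint_domain_of_exists z ⟨-z, hz'⟩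
    have h1 : A.adjoint ⟨z, hzd⟩ = -z := LinearPMap.adjoint_apply_eq hA.dense_domain ⟨z, hzd⟩ hz'
    have hzd' : z ∈ A.domain := hAz ▸ hzd
    have h2 : A ⟨z, hzd'⟩ = -z := by
      rw [← h1]
      exact ((LinearPMap.ext_iff.1 hAz).2 (hf := hzd) (hg := hzd')).symm
    have h3 := hA_nonneg ⟨z, hzd'⟩
    rw [h2, inner_neg_left, real_inner_self_eq_norm_sq] at h3
    have : ‖z‖ ^ 2 = 0 := le_antisymm (by linarith) (sq_nonneg _)
    simpa using this
  obtain ⟨g, hg⟩ : y ∈ L.range := htop ▸ Submodule.mem_top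
  obtain ⟨x, _, h2⟩ := hL g
  exact ⟨x, h2.symm.trans hg⟩

theorem exists_isResolvent [CompleteSpace H] {A : H →ₗ.[ℝ] H} (hA : IsSelfAdjoint A)
    (hA_nonneg : ∀ x : A.domain, 0 ≤ inner ℝ (A x) (x : H)) :
    ∃ T : H →L[ℝ] H, IsResolvent A T := by
  choose S hS using exists_add_eq hA hA_nonneg
  have huniq (x x' : A.domain) (h : (x : H) + A x = (x' : H) + A x') : x = x' := by
    have h1 := sq_norm_add_sq_norm_le hA_nonneg (x - x')
    have h2 : ((x - x' : A.domain) : H) + A (x - x') = 0 := by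
      rw [LinearPMap.map_sub, Submodule.coe_sub]
      rw [← sub_eq_zero] at h
      rw [← h]; abel
    rw [h2] at h1
    have h3 : ‖((x - x' : A.domain) : H)‖ ^ 2 = 0 :=
      le_antisymm (by rw [norm_zero] at h1; nlinarith [sq_nonneg ‖A (x - x')‖]) (sq_nonneg _)
    have h4 : x - x' = 0 := Subtype.ext (norm_eq_zero.1 (pow_eq_zero_iff two_ne_zero |>.1 h3))
    exact sub_eq_zero.1 h4
  let L : H →ₗ[ℝ] H :=
    { toFun := fun x ↦ S x
      map_add' := fun x y ↦ by
        have : S (x + y) = S x + S y := huniq _ _ (by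
          rw [hS, LinearPMap.map_add, Submodule.coe_add]
          conv_lhs => rw [← hS x, ← hS y]
          abel)
        rw [this, Submodule.coe_add]
      map_smul' := fun c x ↦ by
        have : S (c • x) = c • S x := huniq _ _ (by
          rw [hS, LinearPMap.map_smul, Submodule.coe_smul, ← smul_add, hS])
        rw [this, Submodule.coe_smul, RingHom.id_apply] }
  refine ⟨L.mkContinuous 1 fun x ↦ ?_, fun x y ↦ ⟨?_, ?_⟩⟩
  · have h := sq_norm_add_sq_norm_le hA_nonneg (S x)
    rw [hS] at h
    rw [one_mul]
    exact le_of_sq_le_sq (by change ‖(S x : H)‖ ^ 2 ≤ _; nlinarith [sq_nonneg ‖A (S x)‖])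
      (norm_nonneg _)
  · rintro rfl
    exact ⟨(S x).2, hS x⟩
  · rintro ⟨hy, h⟩
    change (S x : H) = y
    rw [huniq (S x) ⟨y, hy⟩ (by rw [hS, h])]

theorem isResolvent_resolvent [CompleteSpace H] {A : H →ₗ.[ℝ] H} (hA : IsSelfAdjoint A)
    (hA_nonneg : ∀ x : A.domain, 0 ≤ inner ℝ (A x) (x : H)) :
    IsResolvent A (resolvent A) := by
  have h := exists_isResolvent hA hA_nonneg
  rw [resolvent, dif_pos h]
  exact h.choose_spec

/-- A symmetric operator with `0 ≤ T ≤ I`. -/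
structure IsPositiveContraction (T : H →L[ℝ] H) : Prop where
  symm : ∀ x y, inner ℝ (T x) y = inner ℝ x (T y)
  nonneg : ∀ x, 0 ≤ inner ℝ (T x) x
  le_one : ∀ x, inner ℝ (T x) x ≤ inner ℝ x x

theorem IsResolvent.isPositiveContraction [CompleteSpace H] {A : H →ₗ.[ℝ] H} {T : H →L[ℝ] H}
    (h : IsResolvent A T) (hA : IsSelfAdjoint A)
    (hA_nonneg : ∀ x : A.domain, 0 ≤ inner ℝ (A x) (x : H)) : IsPositiveContraction T := by
  have hpos (x : H) : 0 ≤ inner ℝ x (T x) - inner ℝ (T x) (T x) := by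
    have := hA_nonneg ⟨T x, h.apply_mem x⟩
    rwa [h.map_apply, inner_sub_left] at this
  refine ⟨fun x y ↦ ?_, fun x ↦ ?_, fun x ↦ ?_⟩
  · have := isFormalAdjoint_self hA ⟨T x, h.apply_mem x⟩ ⟨T y, h.apply_mem y⟩
    simp only [h.map_apply, inner_sub_left, inner_sub_right] at this
    linarith
  · rw [real_inner_comm]
    linarith [hpos x, real_inner_self_nonneg (x := T x)]
  · have h1 := real_inner_self_nonneg (x := x - T x)
    rw [real_inner_sub_sub_self] at h1
    rw [real_inner_comm] at h1 ⊢
    linarith [hpos x, real_inner_comm x (T x)]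

end Resolvent

/-! ### Bernstein coefficients of a polynomial nonnegative on `[0, 1]`. -/

section Bernstein

open Polynomial

/-- This is the factorial moment of a binomial law: multiply the left side by `(X + (1 - X)) ^ (n -
j)` and expand. -/
theorem choose_mul_X_pow (n j : ℕ) (hj : j ≤ n) :
    (n.choose j : ℝ[X]) * X ^ j =
      ∑ k ∈ Finset.range (n + 1), (k.choose j : ℝ[X]) * bernsteinPolynomial ℝ n k := by
  obtain ⟨d, rfl⟩ := Nat.exists_eq_add_of_le hj
  rw [add_assoc, Finset.sum_range_add, Finset.sum_eq_zero, zero_add]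
  · have h : (1 : ℝ[X]) = (X + (1 - X)) ^ d := by simp
    rw [← mul_one (_ * _), h, add_pow, Finset.mul_sum]
    refine Finset.sum_congr rfl fun i hi ↦ ?_
    have h1 := Nat.choose_mul (n := j + d) (k := j + i) (s := j) (Nat.le_add_right _ _)
    rw [Nat.add_sub_cancel_left, Nat.add_sub_cancel_left] at h1
    have h2 : ((j + d).choose (j + i) * (j + i).choose j : ℝ[X]) =
      (j + d).choose j * d.choose i := by exact_mod_cast congrArg (Nat.cast (R := ℝ[X])) h1
    rw [bernsteinPolynomial, Nat.add_sub_add_left, pow_add]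
    linear_combination (-(X ^ j * X ^ i * (1 - X) ^ (d - i)) : ℝ[X]) * h2
  · intro k hk
    rw [Nat.choose_eq_zero_of_lt (Finset.mem_range.1 hk)]
    simp

/-- The ratio is the product over `i < j` of the factors `(k - i) / (n - i)`, truncated at zero.
Each lies in `[0, 1]` and within `i / n` of `k / n`, so the errors add up to at most `j² / n`. -/
theorem abs_choose_div_choose_sub_le (n k : ℕ) (hn : 0 < n) (hk : k ≤ n) (j : ℕ) (hj : j ≤ n) :
    0 ≤ (k.choose j : ℝ) / n.choose j ∧ (k.choose j : ℝ) / n.choose j ≤ 1 ∧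
      |(k.choose j : ℝ) / n.choose j - ((k : ℝ) / n) ^ j| ≤ (j : ℝ) ^ 2 / n := by
  have hn' : (0 : ℝ) < n := by exact_mod_cast hn
  have hq0 : 0 ≤ (k : ℝ) / n := by positivity
  have hq1 : (k : ℝ) / n ≤ 1 := by rw [div_le_one hn']; exact_mod_cast hk
  refine ⟨by positivity, ?_, ?_⟩
  · rw [div_le_one (by exact_mod_cast Nat.choose_pos hj)]
    exact_mod_cast Nat.choose_le_choose j hk
  induction j with
  | zero => simp
  | succ j ih =>
    have ih := ih (by omega)
    have hnj : (0 : ℝ) < n - j := by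
      have : ((j + 1 : ℕ) : ℝ) ≤ n := by exact_mod_cast hj
      push_cast at this; linarith
    have hrec (l : ℕ) : (l.choose (j + 1) : ℝ) * (j + 1) = l.choose j * ((l - j : ℕ) : ℝ) := by
      exact_mod_cast Nat.choose_succ_right_eq l j
    have hj1 : (0 : ℝ) < j + 1 := by positivity
    have hcn : (0 : ℝ) < n.choose j := by exact_mod_cast Nat.choose_pos (by omega : j ≤ n)
    have hfac : (k.choose (j + 1) : ℝ) / n.choose (j + 1) =
        (k.choose j : ℝ) / n.choose j * (((k - j : ℕ) : ℝ) / (n - j)) := by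
      have h1 := hrec k
      have h2 := hrec n
      rw [Nat.cast_sub (by omega)] at h2
      rw [eq_div_of_mul_eq hj1.ne' h1, eq_div_of_mul_eq hj1.ne' h2]
      field_simp
    have hr0 : (0 : ℝ) ≤ (k.choose j : ℝ) / n.choose j := by positivity
    have hr1 : (k.choose j : ℝ) / n.choose j ≤ 1 := by
      rw [div_le_one hcn]
      exact_mod_cast Nat.choose_le_choose j hk
    have hdiff : |((k - j : ℕ) : ℝ) / (n - j) - (k : ℝ) / n| ≤ j / n := by
      -- Natural subtraction truncates for `k ≤ j`; there `k / n ≤ j / n` suffices.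
      rcases le_total k j with hkj | hkj
      · rw [Nat.sub_eq_zero_of_le hkj, Nat.cast_zero, zero_div, zero_sub, abs_neg, abs_of_nonneg hq0]
        gcongr
      · rw [Nat.cast_sub hkj, div_sub_div _ _ hnj.ne' hn'.ne', abs_div, abs_of_pos (mul_pos hnj hn'),
          div_le_div_iff₀ (mul_pos hnj hn') hn']
        have hkn : (k : ℝ) ≤ n := by exact_mod_cast hk
        have hjk : (j : ℝ) ≤ k := by exact_mod_cast hkj
        have : ((k : ℝ) - j) * n - (n - j) * k = -(j * (n - k)) := by ring
        rw [this, abs_neg, abs_of_nonneg (mul_nonneg (by positivity) (by linarith))]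
        nlinarith [mul_nonneg (mul_nonneg (Nat.cast_nonneg (α := ℝ) j) (sub_nonneg.2 hjk)) hn'.le]
    have hp0 : 0 ≤ ((k : ℝ) / n) ^ j := by positivity
    rw [hfac, pow_succ]
    calc _ = |(k.choose j : ℝ) / n.choose j * (((k - j : ℕ) : ℝ) / (n - j) - (k : ℝ) / n) +
          ((k.choose j : ℝ) / n.choose j - ((k : ℝ) / n) ^ j) * ((k : ℝ) / n)| := by ring_nf
      _ ≤ 1 * (j / n) + (j : ℝ) ^ 2 / n * 1 := by
        refine (abs_add_le _ _).trans ?_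
        rw [abs_mul, abs_mul, abs_of_nonneg hr0, abs_of_nonneg hq0]
        gcongr
      _ ≤ _ := by
        rw [one_mul, mul_one, ← add_div]
        gcongr
        push_cast
        nlinarith [Nat.cast_nonneg (α := ℝ) j]

/-- The coefficient `c k` differs from `p(k / n) ≥ 0` by `O(1 / n)`. What matters is that `D` does
not depend on `n`. -/
theorem exists_bernstein_coeff (p : ℝ[X]) (hp : ∀ x ∈ Icc (0 : ℝ) 1, 0 ≤ p.eval x) :
    ∃ D : ℝ, ∀ n : ℕ, p.natDegree < n → ∃ c : ℕ → ℝ, (∀ k ∈ Finset.range (n + 1), -(D / n) ≤ c k) ∧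
      p = ∑ k ∈ Finset.range (n + 1), C (c k) * bernsteinPolynomial ℝ n k := by
  refine ⟨∑ j ∈ Finset.range (p.natDegree + 1), |p.coeff j| * (j : ℝ) ^ 2, fun n hn ↦ ?_⟩
  refine ⟨fun k ↦ ∑ j ∈ Finset.range (p.natDegree + 1),
    p.coeff j * ((k.choose j : ℝ) / n.choose j), fun k hk ↦ ?_, ?_⟩
  · have hn0 : 0 < n := by omega
    have hn' : (0 : ℝ) < n := by exact_mod_cast hn0
    have hkn : k ≤ n := by simpa [Nat.lt_succ_iff] using hk
    have h0 := hp ((k : ℝ) / n) ⟨by positivity, by rw [div_le_one hn']; exact_mod_cast hkn⟩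
    rw [eval_eq_sum_range] at h0
    have h1 : |∑ j ∈ Finset.range (p.natDegree + 1), p.coeff j * ((k.choose j : ℝ) / n.choose j) -
        ∑ j ∈ Finset.range (p.natDegree + 1), p.coeff j * ((k : ℝ) / n) ^ j| ≤
        (∑ j ∈ Finset.range (p.natDegree + 1), |p.coeff j| * (j : ℝ) ^ 2) / n := by
      rw [← Finset.sum_sub_distrib, Finset.sum_div]
      refine (Finset.abs_sum_le_sum_abs _ _).trans (Finset.sum_le_sum fun j hj ↦ ?_)
      rw [← mul_sub, abs_mul, mul_div_assoc]
      have hj' : j ≤ n := by have := Finset.mem_range.1 hj; omega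
      exact mul_le_mul_of_nonneg_left (abs_choose_div_choose_sub_le n k hn0 hkn j hj').2.2
        (abs_nonneg _)
    linarith [(abs_le.1 h1).1]
  · simp only [map_sum, Finset.sum_mul]
    rw [Finset.sum_comm]
    conv_lhs => rw [p.as_sum_range_C_mul_X_pow]
    refine Finset.sum_congr rfl fun j hj ↦ ?_
    have hj' : j ≤ n := by have := Finset.mem_range.1 hj; omega
    have hc : (n.choose j : ℝ) ≠ 0 := by exact_mod_cast (Nat.choose_pos hj').ne'
    have h := choose_mul_X_pow n j hj'
    have h2 : (X : ℝ[X]) ^ j = C ((n.choose j : ℝ)⁻¹) * ((n.choose j : ℝ[X]) * X ^ j) := by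
      rw [← mul_assoc, ← C_eq_natCast, ← C_mul, inv_mul_cancel₀ hc, C_1, one_mul]
    rw [h2, h, Finset.mul_sum, Finset.mul_sum]
    refine Finset.sum_congr rfl fun k _ ↦ ?_
    rw [div_eq_mul_inv, C_mul, C_mul, ← C_eq_natCast]
    ring

end Bernstein

/-! ### Positivity and norm bound for polynomials of `T`. -/

section PolynomialCalculus

open Polynomial

variable {H : Type*} [NormedAddCommGroup H] [InnerProductSpace ℝ H] {T : H →L[ℝ] H}

theorem IsPositiveContraction.aeval_symm (hT : IsPositiveContraction T) (p : ℝ[X]) (x y : H) :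
    inner ℝ (aeval T p x) y = inner ℝ x (aeval T p y) := by
  induction p using Polynomial.induction_on' with
  | add p q hp hq => simp only [map_add, add_apply, inner_add_left,
      inner_add_right, hp, hq]
  | monomial n a =>
    have h (n : ℕ) : inner ℝ ((T ^ n) x) y = inner ℝ x ((T ^ n) y) := by
      induction n generalizing x y with
      | zero => simp
      | succ n ih =>
        have h1 : (T ^ (n + 1)) x = (T ^ n) (T x) := by rw [pow_succ]; rfl
        have h2 : (T ^ (n + 1)) y = T ((T ^ n) y) := by rw [pow_succ']; rfl
        rw [h1, h2, ih, hT.symm]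
    rw [aeval_monomial, Algebra.algebraMap_eq_smul_one, smul_one_mul]
    simp only [smul_apply, inner_smul_left, inner_smul_right, h]
    simp

theorem IsPositiveContraction.aeval_mul_self_mul_nonneg (hT : IsPositiveContraction T) (q p : ℝ[X])
    (hp : ∀ x, 0 ≤ inner ℝ (aeval T p x) x) (x : H) :
    0 ≤ inner ℝ (aeval T (q * q * p) x) x := by
  have : aeval T (q * q * p) x = aeval T q (aeval T p (aeval T q x)) := by
    rw [show q * q * p = q * (p * q) by ring, map_mul, map_mul]; rfl
  rw [this, hT.aeval_symm]
  exact hp _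

/-- Squares split off symmetrically, which reduces both exponents to 0 or 1. The mixed case is `X (1
- X) = X² (1 - X) + (1 - X)² X`. -/
theorem IsPositiveContraction.aeval_X_pow_mul_nonneg (hT : IsPositiveContraction T) (a b : ℕ)
    (x : H) : 0 ≤ inner ℝ (aeval T (X ^ a * (1 - X) ^ b : ℝ[X]) x) x := by
  have hsub (x : H) : 0 ≤ inner ℝ (aeval T (1 - X : ℝ[X]) x) x := by
    have := hT.le_one x
    simp only [map_sub, map_one, aeval_X, sub_apply,
      one_apply_eq_self, inner_sub_left]
    linarith
  have hX (x : H) : 0 ≤ inner ℝ (aeval T (X : ℝ[X]) x) x := by simpa using hT.nonneg x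
  induction a using Nat.twoStepInduction generalizing x with
  | zero =>
    induction b using Nat.twoStepInduction generalizing x with
    | zero => simp
    | one => simpa using hsub x
    | more n ih _ =>
      rw [show (X ^ 0 * (1 - X) ^ (n + 2) : ℝ[X]) =
        (1 - X) * (1 - X) * (X ^ 0 * (1 - X) ^ n) by ring]
      exact hT.aeval_mul_self_mul_nonneg _ _ ih x
  | one =>
    induction b using Nat.twoStepInduction generalizing x with
    | zero => simpa using hX x
    | one =>
      rw [show (X ^ 1 * (1 - X) ^ 1 : ℝ[X]) =
        X * X * (1 - X) + (1 - X) * (1 - X) * X by ring, map_add, add_apply,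
        inner_add_left]
      exact add_nonneg (hT.aeval_mul_self_mul_nonneg _ _ hsub x)
        (hT.aeval_mul_self_mul_nonneg _ _ hX x)
    | more n ih _ =>
      rw [show (X ^ 1 * (1 - X) ^ (n + 2) : ℝ[X]) =
        (1 - X) * (1 - X) * (X ^ 1 * (1 - X) ^ n) by ring]
      exact hT.aeval_mul_self_mul_nonneg _ _ ih x
  | more n ih _ =>
    rw [show (X ^ (n + 2) * (1 - X) ^ b : ℝ[X]) = X * X * (X ^ n * (1 - X) ^ b) by ring]
    exact hT.aeval_mul_self_mul_nonneg _ _ ih x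

theorem IsPositiveContraction.aeval_bernstein_nonneg (hT : IsPositiveContraction T) (n k : ℕ)
    (x : H) : 0 ≤ inner ℝ (aeval T (bernsteinPolynomial ℝ n k) x) x := by
  rw [bernsteinPolynomial, mul_assoc, ← C_eq_natCast, C_mul', map_smul,
    smul_apply, inner_smul_left]
  exact mul_nonneg (by simp) (hT.aeval_X_pow_mul_nonneg _ _ x)

/-- Each Bernstein polynomial of `T` is nonnegative and they sum to the identity, so the form of
`p(T)` is at least `-(D / n) ‖x‖²`; let `n → ∞`. -/
theorem IsPositiveContraction.aeval_nonneg (hT : IsPositiveContraction T) (p : ℝ[X])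
    (hp : ∀ x ∈ Icc (0 : ℝ) 1, 0 ≤ p.eval x) (x : H) : 0 ≤ inner ℝ (aeval T p x) x := by
  obtain ⟨D, hD⟩ := exists_bernstein_coeff p hp
  have hlim : Filter.Tendsto (fun n : ℕ ↦ -(D / n) * inner ℝ x x) Filter.atTop (nhds 0) := by
    simpa using ((tendsto_const_div_atTop_nhds_zero_nat D).neg.mul_const (inner ℝ x x))
  refine le_of_tendsto hlim ((Filter.eventually_gt_atTop p.natDegree).mono fun n hn ↦ ?_)
  obtain ⟨c, hc, hp⟩ := hD n hn
  have h1 : aeval T p = ∑ k ∈ Finset.range (n + 1), c k • aeval T (bernsteinPolynomial ℝ n k) := by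
    conv_lhs => rw [hp]
    simp only [map_sum, C_mul', map_smul]
  have h2 : inner ℝ x x =
      ∑ k ∈ Finset.range (n + 1), inner ℝ (aeval T (bernsteinPolynomial ℝ n k) x) x := by
    rw [← sum_inner, ← sum_apply, ← map_sum, bernsteinPolynomial.sum, map_one,
      one_apply_eq_self]
  rw [h1, h2, sum_apply, sum_inner, Finset.mul_sum]
  refine Finset.sum_le_sum fun k hk ↦ ?_
  rw [smul_apply, real_inner_smul_left]
  exact mul_le_mul_of_nonneg_right (hc k hk) (hT.aeval_bernstein_nonneg n k x)

/-- Positivity applied to `M² - p²` gives `‖p(T) x‖² ≤ M² ‖x‖²`. -/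
theorem IsPositiveContraction.norm_aeval_le (hT : IsPositiveContraction T) (p : ℝ[X]) {M : ℝ}
    (hM : 0 ≤ M) (hp : ∀ x ∈ Icc (0 : ℝ) 1, |p.eval x| ≤ M) : ‖aeval T p‖ ≤ M := by
  refine ContinuousLinearMap.opNorm_le_bound _ hM fun x ↦ ?_
  have h := hT.aeval_nonneg (C (M ^ 2) - p * p) (fun y hy ↦ by
    have h1 := sq_le_sq' (abs_le.1 (hp y hy)).1 (abs_le.1 (hp y hy)).2
    rw [eval_sub, eval_C, eval_mul]
    nlinarith) x
  have h2 : aeval T (p * p) x = aeval T p (aeval T p x) := by rw [map_mul]; rfl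
  rw [map_sub, sub_apply, inner_sub_left, aeval_C, h2, hT.aeval_symm,
    Algebra.algebraMap_eq_smul_one, smul_apply, real_inner_smul_left,
    one_apply_eq_self, real_inner_self_eq_norm_sq, real_inner_self_eq_norm_sq] at h
  refine le_of_sq_le_sq ?_ (by positivity)
  rw [mul_pow]
  linarith

end PolynomialCalculus

/-! ### Continuous functional calculus on `[0, 1]`. -/

section ContinuousCalculus

open Polynomial

variable {H : Type*} [NormedAddCommGroup H] [InnerProductSpace ℝ H]

/-- The inclusion of polynomials into the continuous functions on `[0, 1]`. -/
noncomputable def polynomialOnUnitInterval : ℝ[X] →ₗ[ℝ] C(Icc (0 : ℝ) 1, ℝ) :=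
  (toContinuousMapOnAlgHom (Icc (0 : ℝ) 1)).toLinearMap

theorem polynomialOnUnitInterval_apply (p : ℝ[X]) (x : Icc (0 : ℝ) 1) :
    polynomialOnUnitInterval p x = p.eval (x : ℝ) := rfl

theorem denseRange_polynomialOnUnitInterval : DenseRange polynomialOnUnitInterval := by
  intro f
  refine Metric.mem_closure_iff.2 fun ε hε ↦ ?_
  obtain ⟨p, hp⟩ := exists_polynomial_near_continuousMap 0 1 f ε hε
  exact ⟨_, ⟨p, rfl⟩, by rw [dist_comm, dist_eq_norm]; exact hp⟩

variable {T : H →L[ℝ] H}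

theorem IsPositiveContraction.norm_aeval_le_norm (hT : IsPositiveContraction T) (p : ℝ[X]) :
    ‖(aeval T : ℝ[X] →ₐ[ℝ] (H →L[ℝ] H)).toLinearMap p‖ ≤ 1 * ‖polynomialOnUnitInterval p‖ := by
  rw [one_mul]
  exact hT.norm_aeval_le p (norm_nonneg _) fun x hx ↦
    (polynomialOnUnitInterval p).norm_coe_le_norm ⟨x, hx⟩

variable [CompleteSpace H]

/-- The continuous functional calculus on `[0, 1]` of a symmetric operator with `0 ≤ T ≤ I`. -/
noncomputable def calculus (T : H →L[ℝ] H) : C(Icc (0 : ℝ) 1, ℝ) →L[ℝ] (H →L[ℝ] H) :=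
  (aeval T : ℝ[X] →ₐ[ℝ] (H →L[ℝ] H)).toLinearMap.extendOfNorm polynomialOnUnitInterval

theorem IsPositiveContraction.calculus_polynomial (hT : IsPositiveContraction T) (p : ℝ[X]) :
    calculus T (polynomialOnUnitInterval p) = aeval T p :=
  LinearMap.extendOfNorm_eq denseRange_polynomialOnUnitInterval ⟨1, hT.norm_aeval_le_norm⟩ p

theorem IsPositiveContraction.norm_calculus_le (hT : IsPositiveContraction T)
    (f : C(Icc (0 : ℝ) 1, ℝ)) : ‖calculus T f‖ ≤ ‖f‖ := by
  rw [← one_mul ‖f‖]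
  exact LinearMap.norm_extendOfNorm_apply_le denseRange_polynomialOnUnitInterval 1
    hT.norm_aeval_le_norm f

theorem IsPositiveContraction.norm_calculus_apply_le (hT : IsPositiveContraction T)
    (f : C(Icc (0 : ℝ) 1, ℝ)) {C : ℝ} (hC : 0 ≤ C) (hf : ∀ x, |f x| ≤ C) (y : H) :
    ‖calculus T f y‖ ≤ C * ‖y‖ :=
  (calculus T f).le_of_opNorm_le ((hT.norm_calculus_le f).trans
    ((ContinuousMap.norm_le f hC).2 hf)) y

theorem IsPositiveContraction.calculus_mul (hT : IsPositiveContraction T)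
    (f g : C(Icc (0 : ℝ) 1, ℝ)) : calculus T (f * g) = calculus T f * calculus T g := by
  refine denseRange_polynomialOnUnitInterval.induction_on₂ (p := fun f g ↦
    calculus T (f * g) = calculus T f * calculus T g)
    (isClosed_eq (by fun_prop) (by fun_prop)) (fun p q ↦ ?_) f g
  have : polynomialOnUnitInterval p * polynomialOnUnitInterval q =
    polynomialOnUnitInterval (p * q) := (map_mul (toContinuousMapOnAlgHom _) p q).symm
  rw [this, hT.calculus_polynomial, hT.calculus_polynomial, hT.calculus_polynomial, map_mul]

theorem IsPositiveContraction.calculus_mul_apply (hT : IsPositiveContraction T)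
    (f g : C(Icc (0 : ℝ) 1, ℝ)) (x : H) :
    calculus T (f * g) x = calculus T f (calculus T g x) := by
  rw [hT.calculus_mul]; rfl

theorem IsPositiveContraction.calculus_one (hT : IsPositiveContraction T) :
    calculus T 1 = 1 := by
  have : (1 : C(Icc (0 : ℝ) 1, ℝ)) = polynomialOnUnitInterval 1 :=
    (map_one (toContinuousMapOnAlgHom _)).symm
  rw [this, hT.calculus_polynomial, map_one]

theorem IsPositiveContraction.calculus_symm (hT : IsPositiveContraction T)
    (f : C(Icc (0 : ℝ) 1, ℝ)) (x y : H) :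
    inner ℝ (calculus T f x) y = inner ℝ x (calculus T f y) := by
  refine denseRange_polynomialOnUnitInterval.induction_on (p := fun f ↦
    inner ℝ (calculus T f x) y = inner ℝ x (calculus T f y)) f
    (isClosed_eq (by fun_prop) (by fun_prop)) (fun p ↦ ?_)
  rw [hT.calculus_polynomial, hT.aeval_symm]

/-- The function `x ↦ x` on `[0, 1]`. -/
def unitId : C(Icc (0 : ℝ) 1, ℝ) := ⟨fun x ↦ x, by fun_prop⟩

@[simp] theorem unitId_apply (x : Icc (0 : ℝ) 1) : unitId x = x := rfl

theorem IsPositiveContraction.calculus_unitId (hT : IsPositiveContraction T) :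
    calculus T unitId = T := by
  have : unitId = polynomialOnUnitInterval X := by
    ext x; simp [polynomialOnUnitInterval_apply]
  rw [this, hT.calculus_polynomial, aeval_X]

theorem IsPositiveContraction.calculus_pow (hT : IsPositiveContraction T)
    (f : C(Icc (0 : ℝ) 1, ℝ)) (n : ℕ) : calculus T (f ^ n) = calculus T f ^ n := by
  induction n with
  | zero => simp [hT.calculus_one]
  | succ n ih => rw [pow_succ, hT.calculus_mul, ih, pow_succ]

end ContinuousCalculus

/-! ### The binomial series of `y ^ α` on the closed interval `[0, 1]`. -/

section BinomialSeries

theorem succ_mul_choose_succ (α : ℝ) (k : ℕ) :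
    ((k : ℝ) + 1) * Ring.choose α (k + 1) = Ring.choose α k * (α - k) := by
  have h := Ring.choose_smul_choose α (n := k + 1) (k := k) (Nat.le_succ k)
  rw [Nat.add_sub_cancel_left, Ring.choose_one_right, Nat.choose_succ_self_right,
    nsmul_eq_mul] at h
  exact_mod_cast h

/-- With `c k` the binomial coefficient, for `k > α` the recursion gives `α |c k| = k |c k| - (k +
1) |c (k + 1)|`, which telescopes. -/
theorem summable_abs_choose {α : ℝ} (hα : 0 ≤ α) : Summable fun k : ℕ ↦ |Ring.choose α k| := by
  rcases hα.eq_or_lt with rfl | hα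
  · refine summable_of_ne_finset_zero (s := {0}) fun k hk ↦ ?_
    rw [Ring.choose_zero_pos ℝ (Nat.pos_of_ne_zero (by simpa using hk)), abs_zero]
  obtain ⟨N, hN⟩ := exists_nat_gt α
  rw [← summable_nat_add_iff N]
  have hrec (k : ℕ) : α * |Ring.choose α (k + N)| = ((k + N : ℕ) : ℝ) * |Ring.choose α (k + N)| -
      ((k + 1 + N : ℕ) : ℝ) * |Ring.choose α (k + 1 + N)| := by
    have h := congrArg abs (succ_mul_choose_succ α (k + N))
    have hneg : α - ((k + N : ℕ) : ℝ) ≤ 0 := by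
      push_cast
      linarith [Nat.cast_nonneg (α := ℝ) k]
    rw [abs_mul, abs_mul, abs_of_nonpos hneg, abs_of_nonneg (by positivity)] at h
    rw [show k + 1 + N = k + N + 1 by omega]
    push_cast at h ⊢
    linarith
  have hα' : Summable fun k : ℕ ↦ α * |Ring.choose α (k + N)| := by
    refine summable_of_sum_range_le (c := (N : ℝ) * |Ring.choose α N|)
      (fun k ↦ by positivity) fun n ↦ ?_
    simp_rw [hrec]
    rw [Finset.sum_range_sub' (fun k : ℕ ↦ ((k + N : ℕ) : ℝ) * |Ring.choose α (k + N)|)]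
    have : 0 ≤ ((n + N : ℕ) : ℝ) * |Ring.choose α (n + N)| := by positivity
    simp only [zero_add]
    linarith
  exact (summable_mul_left_iff hα.ne').1 hα'

theorem norm_choose_mul_pow_le (α : ℝ) (k : ℕ) {y : ℝ} (hy : y ∈ Icc (0 : ℝ) 1) :
    ‖(-1) ^ k * Ring.choose α k * (1 - y) ^ k‖ ≤ |Ring.choose α k| := by
  rw [norm_mul, norm_mul, norm_pow, norm_pow, norm_neg, norm_one, one_pow, one_mul,
    Real.norm_eq_abs]
  refine mul_le_of_le_one_right (abs_nonneg _) (pow_le_one₀ (norm_nonneg _) ?_)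
  rw [Real.norm_eq_abs, abs_le]
  constructor <;> linarith [hy.1, hy.2]

theorem hasSum_choose_of_pos (α : ℝ) {y : ℝ} (hy : y ∈ Ioc (0 : ℝ) 1) :
    HasSum (fun k : ℕ ↦ (-1) ^ k * Ring.choose α k * (1 - y) ^ k) (y ^ α) := by
  have h := (Real.one_add_rpow_hasFPowerSeriesOnBall_zero (a := α)).hasSum (y := y - 1) (by
    rw [Metric.mem_eball, edist_zero_right, ← ofReal_norm, ← ENNReal.ofReal_one,
      ENNReal.ofReal_lt_ofReal_iff one_pos, Real.norm_eq_abs, abs_lt]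
    constructor <;> linarith [hy.1, hy.2])
  rw [zero_add, add_sub_cancel] at h
  refine (congrArg (HasSum · (y ^ α)) (funext fun k ↦ ?_)).mpr h
  rw [binomialSeries_apply, List.ofFn_const, List.prod_replicate, smul_eq_mul,
    show y - 1 = -1 * (1 - y) by ring, mul_pow]
  ring

/-- Analyticity gives the identity for `y > 0`. Absolute summability makes the series continuous up
to `y = 0`, where the identity follows by closure. -/
theorem tsum_choose {α : ℝ} (hα : 0 ≤ α) {y : ℝ} (hy : y ∈ Icc (0 : ℝ) 1) :
    ∑' k : ℕ, (-1) ^ k * Ring.choose α k * (1 - y) ^ k = y ^ α := by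
  have h1 : ContinuousOn (fun y : ℝ ↦ ∑' k : ℕ, (-1) ^ k * Ring.choose α k * (1 - y) ^ k)
      (Icc 0 1) :=
    continuousOn_tsum (fun k ↦ by fun_prop) (summable_abs_choose hα)
      fun k y hy ↦ norm_choose_mul_pow_le α k hy
  have h2 : ContinuousOn (fun y : ℝ ↦ y ^ α) (Icc 0 1) :=
    (Real.continuous_rpow_const hα).continuousOn
  have h3 : EqOn (fun y : ℝ ↦ ∑' k : ℕ, (-1) ^ k * Ring.choose α k * (1 - y) ^ k)
      (fun y : ℝ ↦ y ^ α) (Ioc 0 1) := fun y hy ↦ (hasSum_choose_of_pos α hy).tsum_eq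
  exact h3.of_subset_closure h1 h2 Ioc_subset_Icc_self
    (by rw [closure_Ioc zero_ne_one]) hy

end BinomialSeries

/-! ### Fractional powers of `T` and `A` through the calculus. -/

section FractionalPower

variable {H : Type*} [NormedAddCommGroup H] [InnerProductSpace ℝ H] [CompleteSpace H]
  {T : H →L[ℝ] H}

/-- The power `g ^ α` of a function on `[0, 1]`. -/
noncomputable def rpowFun (g : C(Icc (0 : ℝ) 1, ℝ)) {α : ℝ} (hα : 0 ≤ α) : C(Icc (0 : ℝ) 1, ℝ) :=
  ⟨fun x ↦ g x ^ α, (Real.continuous_rpow_const hα).comp g.continuous⟩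

@[simp] theorem rpowFun_apply (g : C(Icc (0 : ℝ) 1, ℝ)) {α : ℝ} (hα : 0 ≤ α)
    (x : Icc (0 : ℝ) 1) : rpowFun g hα x = g x ^ α := rfl

theorem IsPositiveContraction.contractionPow_calculus (hT : IsPositiveContraction T)
    (g : C(Icc (0 : ℝ) 1, ℝ)) (hg : ∀ x, g x ∈ Icc (0 : ℝ) 1) {α : ℝ} (hα : 0 ≤ α) :
    contractionPow (calculus T g) α = calculus T (rpowFun g hα) := by
  let F : ℕ → C(Icc (0 : ℝ) 1, ℝ) := fun k ↦ ((-1 : ℝ) ^ k * Ring.choose α k) • (1 - g) ^ k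
  have hF : Summable F := by
    refine Summable.of_norm_bounded (summable_abs_choose hα) fun k ↦ ?_
    refine (ContinuousMap.norm_le _ (abs_nonneg _)).2 fun x ↦ ?_
    simpa [F] using norm_choose_mul_pow_le α k (hg x)
  have hsum : ∑' k, F k = rpowFun g hα := by
    ext x
    rw [← ContinuousMap.tsum_apply hF, rpowFun_apply, ← tsum_choose hα (hg x)]
    rfl
  rw [contractionPow, ← hsum, (calculus T).map_tsum hF]
  refine tsum_congr fun k ↦ ?_
  rw [map_smul, hT.calculus_pow, map_sub, hT.calculus_one]

theorem unitId_mem (x : Icc (0 : ℝ) 1) : unitId x ∈ Icc (0 : ℝ) 1 := x.2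

theorem one_sub_unitId_mem (x : Icc (0 : ℝ) 1) : (1 - unitId) x ∈ Icc (0 : ℝ) 1 :=
  ⟨sub_nonneg.2 x.2.2, sub_le_self _ x.2.1⟩

theorem IsPositiveContraction.calculus_one_sub_unitId (hT : IsPositiveContraction T) :
    calculus T (1 - unitId) = 1 - T := by
  rw [map_sub, hT.calculus_one, hT.calculus_unitId]

theorem IsPositiveContraction.contractionPow_self (hT : IsPositiveContraction T) {α : ℝ}
    (hα : 0 ≤ α) : contractionPow T α = calculus T (rpowFun unitId hα) := by
  conv_lhs => rw [← hT.calculus_unitId]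
  exact hT.contractionPow_calculus unitId unitId_mem hα

theorem IsPositiveContraction.contractionPow_one_sub (hT : IsPositiveContraction T) {α : ℝ}
    (hα : 0 ≤ α) : contractionPow (1 - T) α = calculus T (rpowFun (1 - unitId) hα) := by
  rw [← hT.calculus_one_sub_unitId]
  exact hT.contractionPow_calculus _ one_sub_unitId_mem hα

theorem rpowFun_mul {g : C(Icc (0 : ℝ) 1, ℝ)} (hg : ∀ x, g x ∈ Icc (0 : ℝ) 1) {α β : ℝ}
    (hα : 0 ≤ α) (hβ : 0 ≤ β) (n : ℕ) (h : α + β = n) :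
    rpowFun g hα * rpowFun g hβ = g ^ n := by
  ext x
  rw [ContinuousMap.mul_apply, rpowFun_apply, rpowFun_apply,
    ← Real.rpow_add_of_nonneg (hg x).1 hα hβ, h, Real.rpow_natCast, ContinuousMap.pow_apply]

theorem IsPositiveContraction.pow_apply_eq (hT : IsPositiveContraction T) {α β : ℝ}
    (hα : 0 ≤ α) (hβ : 0 ≤ β) (n : ℕ) (h : α + β = n) (y : H) :
    (T ^ n) y = calculus T (rpowFun unitId hα) (calculus T (rpowFun unitId hβ) y) := by
  rw [← hT.calculus_mul_apply, rpowFun_mul unitId_mem hα hβ n h, hT.calculus_pow,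
    hT.calculus_unitId]

/-- For an integer `n ≥ α`, the injective operator `T ^ n` factors as `T ^ (n - α)` after `T ^ α`.
-/
theorem IsPositiveContraction.rpow_injective (hT : IsPositiveContraction T)
    (hinj : Function.Injective T) {α : ℝ} (hα : 0 ≤ α) :
    Function.Injective (calculus T (rpowFun unitId hα)) := by
  obtain ⟨n, hn⟩ := exists_nat_ge α
  have h : ⇑(T ^ n) = calculus T (rpowFun unitId (sub_nonneg.2 hn)) ∘
      calculus T (rpowFun unitId hα) := by
    funext y
    exact hT.pow_apply_eq _ _ n (by ring) y
  have h2 : Function.Injective ⇑(T ^ n) := by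
    rw [FunLike.coe_pow_eq_iterate]
    exact hinj.iterate n
  rw [h] at h2
  exact h2.of_comp

variable {A : H →ₗ.[ℝ] H}

theorem IsResolvent.mem_graph_pow (hR : IsResolvent A (resolvent A))
    (hT : IsPositiveContraction (resolvent A)) {α : ℝ} (hα : 0 ≤ α) (z : H) :
    (calculus (resolvent A) (rpowFun unitId hα) z,
      calculus (resolvent A) (rpowFun (1 - unitId) hα) z) ∈ (pow A α).graph := by
  set f := (contractionPow (resolvent A) α).toLinearMap.toPMap ⊤
  -- Only for a trivial kernel is the partial map `inverse` the genuine inverse.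
  have hker : LinearMap.ker f.toFun = ⊥ := by
    rw [LinearMap.ker_eq_bot]
    intro x y hxy
    refine Subtype.ext (hT.rpow_injective hR.injective hα ?_)
    rw [← hT.contractionPow_self hα]
    exact hxy
  have h1 := LinearPMap.mem_inverse_graph hker ⟨z, Submodule.mem_top⟩
  obtain ⟨y, hy1, hy2⟩ := (LinearPMap.mem_graph_iff _).1 h1
  refine (LinearPMap.mem_graph_iff _).2 ⟨y, ?_, ?_⟩
  · rw [← hT.contractionPow_self hα]
    exact hy1
  · rw [← hT.contractionPow_one_sub hα]
    exact congrArg (contractionPow (1 - resolvent A) α) hy2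

theorem IsResolvent.val_pow (hR : IsResolvent A (resolvent A))
    (hT : IsPositiveContraction (resolvent A)) {α : ℝ} (hα : 0 ≤ α) (z : H) :
    val (pow A α) (calculus (resolvent A) (rpowFun unitId hα) z) =
      calculus (resolvent A) (rpowFun (1 - unitId) hα) z := by
  obtain ⟨y, hy1, hy2⟩ := (LinearPMap.mem_graph_iff _).1 (hR.mem_graph_pow hT hα z)
  simp only at hy1 hy2
  rw [val, ← hy1, dif_pos y.2, ← hy2]

/-- `|A^{1/2} x|² = ⟨A x, x⟩` on `D(A)`. -/
theorem IsResolvent.sq_norm_val_pow_half (hR : IsResolvent A (resolvent A))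
    (hT : IsPositiveContraction (resolvent A)) {x : H} (hx : x ∈ A.domain) :
    ‖val (pow A (1 / 2)) x‖ ^ 2 = inner ℝ (val A x) x := by
  have hα : (0 : ℝ) ≤ 1 / 2 := by norm_num
  obtain ⟨y, rfl⟩ := hR.exists_eq hx
  have h1 := hT.pow_apply_eq hα hα 1 (by norm_num) y
  rw [pow_one] at h1
  -- For `x = T y`, both sides are the quadratic form at `y` of the function `(1 - x) x` of `T`.
  have h2 : rpowFun (1 - unitId) hα * rpowFun unitId hα *
      (rpowFun (1 - unitId) hα * rpowFun unitId hα) = (1 - unitId) * unitId := by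
    rw [mul_mul_mul_comm, rpowFun_mul one_sub_unitId_mem hα hα 1 (by norm_num),
      rpowFun_mul unitId_mem hα hα 1 (by norm_num), pow_one, pow_one]
  have h3 : y - resolvent A y = calculus (resolvent A) (1 - unitId) y := by
    rw [hT.calculus_one_sub_unitId]; rfl
  have h4 : resolvent A y = calculus (resolvent A) unitId y := by rw [hT.calculus_unitId]
  conv_lhs => rw [h1, hR.val_pow hT hα, ← hT.calculus_mul_apply]
  rw [← real_inner_self_eq_norm_sq, hR.val_apply, h3, h4, hT.calculus_symm, hT.calculus_symm,
    ← hT.calculus_mul_apply, ← hT.calculus_mul_apply, h2]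

end FractionalPower

/-! ### Scalar estimates for the functions defining `exp (-s A)`. -/

section ExponentialEstimates

theorem abs_exp_neg_sub_exp_neg_le {a b : ℝ} (ha : 0 ≤ a) (hb : 0 ≤ b) :
    |Real.exp (-a) - Real.exp (-b)| ≤ |a - b| := by
  wlog h : a ≤ b generalizing a b
  · rw [abs_sub_comm, abs_sub_comm a]
    exact this hb ha (le_of_not_ge h)
  have h1 : Real.exp (-b) = Real.exp (-a) * Real.exp (-(b - a)) := by
    rw [← Real.exp_add]; ring_nf
  have h2 := Real.add_one_le_exp (-(b - a))
  have h3 : Real.exp (-(b - a)) ≤ 1 := Real.exp_le_one_iff.2 (by linarith)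
  have h4 : Real.exp (-a) ≤ 1 := Real.exp_le_one_iff.2 (by linarith)
  have h5 := Real.exp_pos (-a)
  rw [abs_sub_comm a, abs_of_nonneg (sub_nonneg.2 h), h1, abs_le]
  constructor <;> nlinarith

/-- Put `d = a - b`. If `d ≥ 0`, use `exp (-d) ≤ 1 / (1 + d)`. If `d ≤ 0`, factor out `exp (-a)`
instead and use `exp d ≥ 1 + d`, so that the bound has no exponentially growing constant. -/
theorem abs_exp_neg_taylor_le {a b : ℝ} (ha : 0 ≤ a) (hb : 0 ≤ b) :
    |Real.exp (-a) - Real.exp (-b) + (a - b) * Real.exp (-b)| ≤ (a - b) ^ 2 := by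
  have hb1 : Real.exp (-b) ≤ 1 := Real.exp_le_one_iff.2 (by linarith)
  have hb0 := Real.exp_pos (-b)
  have h1 : Real.exp (-a) = Real.exp (-b) * Real.exp (-(a - b)) := by
    rw [← Real.exp_add]; ring_nf
  have h2 := Real.add_one_le_exp (-(a - b))
  have h0 : 0 ≤ Real.exp (-(a - b)) - 1 + (a - b) := by linarith
  have h3 : Real.exp (-a) - Real.exp (-b) + (a - b) * Real.exp (-b) =
      Real.exp (-b) * (Real.exp (-(a - b)) - 1 + (a - b)) := by rw [h1]; ring
  rw [h3, abs_of_nonneg (mul_nonneg hb0.le h0)]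
  rcases le_total b a with h | h
  · have h4 := Real.add_one_le_exp (a - b)
    have h5 : Real.exp (-(a - b)) * Real.exp (a - b) = 1 := by rw [← Real.exp_add]; simp
    have h6 := Real.exp_pos (-(a - b))
    have h7 : Real.exp (-(a - b)) * (1 + (a - b)) ≤ 1 := by nlinarith
    have h8 : Real.exp (-(a - b)) - 1 + (a - b) ≤ (a - b) ^ 2 := by
      by_contra hcon
      push Not at hcon
      nlinarith [mul_pos (sub_pos.2 hcon) (by linarith : 0 < 1 + (a - b)),
        mul_nonneg (sub_nonneg.2 h) (sq_nonneg (a - b))]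
    nlinarith
  · rw [← h3]
    have h4 := Real.add_one_le_exp (-(b - a))
    have h5 : Real.exp (-b) = Real.exp (-a) * Real.exp (-(b - a)) := by
      rw [← Real.exp_add]; ring_nf
    have h6 : Real.exp (-a) ≤ 1 := Real.exp_le_one_iff.2 (by linarith)
    have h7 := Real.exp_pos (-a)
    have h8 : 1 - (1 + (b - a)) * Real.exp (-(b - a)) ≤ (a - b) ^ 2 := by nlinarith
    rw [h5]
    calc _ = Real.exp (-a) * (1 - (1 + (b - a)) * Real.exp (-(b - a))) := by ring
      _ ≤ Real.exp (-a) * (a - b) ^ 2 := mul_le_mul_of_nonneg_left h8 h7.le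
      _ ≤ _ := mul_le_of_le_one_left (sq_nonneg _) h6

/-- The function `x ↦ exp (-s (x⁻¹ - 1))` on `[0, 1]`, extended by its limit at `x = 0`. -/
noncomputable def expFun (s : ℝ) : C(Icc (0 : ℝ) 1, ℝ) :=
  -- At `s = 0` the second branch would give 0, since `x / 0 = 0`.
  if s ≤ 0 then 1 else
    ⟨fun x ↦ Real.exp s * expNegInvGlue (x / s), by
      have := (expNegInvGlue.contDiff (n := 0)).continuous
      fun_prop⟩

theorem expFun_zero : expFun 0 = 1 := by rw [expFun, if_pos le_rfl]

theorem expFun_apply_of_pos {s : ℝ} (hs : 0 ≤ s) {x : Icc (0 : ℝ) 1} (hx : 0 < (x : ℝ)) :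
    expFun s x = Real.exp (-(s * ((1 - x) / x))) := by
  rcases hs.eq_or_lt with rfl | hs
  · simp [expFun_zero]
  · rw [expFun, if_neg (not_le.2 hs), ContinuousMap.coe_mk, expNegInvGlue,
      if_neg (not_le.2 (div_pos hx hs)), ← Real.exp_add]
    congr 1
    field_simp
    ring

theorem expFun_apply_zero {s : ℝ} (hs : 0 < s) {x : Icc (0 : ℝ) 1} (hx : (x : ℝ) = 0) :
    expFun s x = 0 := by
  rw [expFun, if_neg (not_le.2 hs), ContinuousMap.coe_mk, hx]
  simp

theorem expFun_mem {s : ℝ} (hs : 0 ≤ s) (x : Icc (0 : ℝ) 1) : expFun s x ∈ Icc (0 : ℝ) 1 := by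
  rcases x.2.1.eq_or_lt with hx | hx
  · rcases hs.eq_or_lt with rfl | hs
    · simp [expFun_zero]
    · simp [expFun_apply_zero hs hx.symm]
  · rw [expFun_apply_of_pos hs hx]
    refine ⟨(Real.exp_pos _).le, Real.exp_le_one_iff.2 ?_⟩
    have := div_nonneg (sub_nonneg.2 x.2.2) hx.le
    nlinarith

theorem expFun_add {s r : ℝ} (hs : 0 ≤ s) (hr : 0 ≤ r) :
    expFun (s + r) = expFun s * expFun r := by
  rcases hs.eq_or_lt with rfl | hs
  · rw [zero_add, expFun_zero, one_mul]
  ext x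
  rw [ContinuousMap.mul_apply]
  rcases x.2.1.eq_or_lt with hx | hx
  · rw [expFun_apply_zero (by linarith) hx.symm, expFun_apply_zero hs hx.symm, zero_mul]
  · rw [expFun_apply_of_pos (by linarith) hx, expFun_apply_of_pos hs.le hx,
      expFun_apply_of_pos hr hx, ← Real.exp_add]
    ring_nf

/-- The Lipschitz constant in `s` is `(1 - x) / x`; the factor `x` cancels its pole. -/
theorem abs_mul_expFun_sub_le {s r : ℝ} (hs : 0 ≤ s) (hr : 0 ≤ r) (x : Icc (0 : ℝ) 1) :
    |(x : ℝ) * (expFun s x - expFun r x)| ≤ |s - r| := by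
  rcases x.2.1.eq_or_lt with hx | hx
  · rw [← hx, zero_mul, abs_zero]
    exact abs_nonneg _
  have hl := div_nonneg (sub_nonneg.2 x.2.2) hx.le
  have h := abs_exp_neg_sub_exp_neg_le (mul_nonneg hs hl) (mul_nonneg hr hl)
  rw [expFun_apply_of_pos hs hx, expFun_apply_of_pos hr hx, abs_mul, abs_of_pos hx]
  calc _ ≤ (x : ℝ) * |s * ((1 - x) / x) - r * ((1 - x) / x)| := by gcongr
    _ = |s - r| * (1 - x) := by
      rw [← sub_mul, abs_mul, abs_of_nonneg hl]
      field_simp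
    _ ≤ _ := mul_le_of_le_one_right (abs_nonneg _) (by linarith)

/-- The second-order remainder costs `((1 - x) / x)²`, which two factors `x` absorb. -/
theorem abs_expFun_taylor_le {s r : ℝ} (hs : 0 ≤ s) (hr : 0 ≤ r) (x : Icc (0 : ℝ) 1) :
    |(x : ℝ) * (x * (expFun s x - expFun r x) + (s - r) * ((1 - x) * expFun r x))| ≤
      (s - r) ^ 2 := by
  rcases x.2.1.eq_or_lt with hx | hx
  · rw [← hx, zero_mul, abs_zero]
    exact sq_nonneg _
  have hl := div_nonneg (sub_nonneg.2 x.2.2) hx.le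
  have h := abs_exp_neg_taylor_le (mul_nonneg hs hl) (mul_nonneg hr hl)
  rw [expFun_apply_of_pos hs hx, expFun_apply_of_pos hr hx]
  set a := s * ((1 - (x : ℝ)) / x)
  set b := r * ((1 - (x : ℝ)) / x)
  have hab : (x : ℝ) * (a - b) = (s - r) * (1 - x) := by
    simp only [a, b]
    field_simp
  calc _ = |(x : ℝ) ^ 2 * (Real.exp (-a) - Real.exp (-b) + (a - b) * Real.exp (-b))| := by
        congr 1
        linear_combination (-(x : ℝ) * Real.exp (-b)) * hab
    _ ≤ (x : ℝ) ^ 2 * (a - b) ^ 2 := by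
        rw [abs_mul, abs_of_nonneg (sq_nonneg (x : ℝ))]
        gcongr
    _ = (s - r) ^ 2 * (1 - x) ^ 2 := by rw [← mul_pow, hab, mul_pow]
    _ ≤ _ := mul_le_of_le_one_right (sq_nonneg _)
        (pow_le_one₀ (by linarith [x.2.2]) (by linarith))

/-- This is the smoothing effect: `exp (-s / x)` vanishes at `x = 0` faster than every power of `x`.
-/
theorem exists_pow_mul_eq_expFun {s : ℝ} (hs : 0 < s) (n : ℕ) :
    ∃ q : C(Icc (0 : ℝ) 1, ℝ), unitId ^ n * q = expFun s := by
  have hc := expNegInvGlue.continuous_polynomial_eval_inv_mul (Polynomial.X ^ n)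
  simp only [Polynomial.eval_pow, Polynomial.eval_X] at hc
  refine ⟨⟨fun x ↦ Real.exp s * (s⁻¹ ^ n * ((x / s : ℝ)⁻¹ ^ n * expNegInvGlue (x / s))), ?_⟩, ?_⟩
  · have h2 : Continuous fun x : Icc (0 : ℝ) 1 ↦ (x : ℝ) / s := by fun_prop
    exact continuous_const.mul (continuous_const.mul (hc.comp h2))
  · ext x
    rw [ContinuousMap.mul_apply, ContinuousMap.pow_apply, unitId_apply, ContinuousMap.coe_mk]
    rcases x.2.1.eq_or_lt with hx | hx
    · rw [expFun_apply_zero hs hx.symm, ← hx]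
      simp
    · rw [expFun, if_neg (not_le.2 hs), ContinuousMap.coe_mk]
      have : (x : ℝ) ^ n * (s⁻¹ ^ n * (x / s : ℝ)⁻¹ ^ n) = 1 := by
        rw [← mul_pow, ← mul_pow]
        have : (x : ℝ) * (s⁻¹ * (x / s : ℝ)⁻¹) = 1 := by field_simp
        rw [this, one_pow]
      linear_combination (Real.exp s * expNegInvGlue (x / s)) * this

end ExponentialEstimates

/-! ### The semigroup: continuity, derivative, energy. -/

section Semigroup

variable {H : Type*} [NormedAddCommGroup H] [InnerProductSpace ℝ H] [CompleteSpace H]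
  {T : H →L[ℝ] H}

/-- The semigroup `exp (-s A)`, `s ≥ 0`, in terms of `T = (I + A)⁻¹`. -/
noncomputable def semigroup (T : H →L[ℝ] H) (s : ℝ) : H →L[ℝ] H := calculus T (expFun s)

theorem IsPositiveContraction.semigroup_zero_apply (hT : IsPositiveContraction T) (y : H) :
    semigroup T 0 y = y := by
  rw [semigroup, expFun_zero, hT.calculus_one]; rfl

theorem IsPositiveContraction.semigroup_add_apply (hT : IsPositiveContraction T) {s r : ℝ}
    (hs : 0 ≤ s) (hr : 0 ≤ r) (y : H) :
    semigroup T (s + r) y = semigroup T s (semigroup T r y) := by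
  rw [semigroup, expFun_add hs hr, hT.calculus_mul_apply]; rfl

theorem IsPositiveContraction.semigroup_map (hT : IsPositiveContraction T) (s : ℝ) (y : H) :
    semigroup T s (T y) = T (semigroup T s y) := by
  have h (z : H) : T z = calculus T unitId z := by rw [hT.calculus_unitId]
  rw [h, h, semigroup, ← hT.calculus_mul_apply, mul_comm, hT.calculus_mul_apply]

theorem IsPositiveContraction.exists_pow_semigroup (hT : IsPositiveContraction T) {s : ℝ}
    (hs : 0 < s) (n : ℕ) : ∃ R : H →L[ℝ] H, ∀ y, semigroup T s y = (T ^ n) (R y) := by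
  obtain ⟨q, hq⟩ := exists_pow_mul_eq_expFun hs n
  refine ⟨calculus T q, fun y ↦ ?_⟩
  rw [semigroup, ← hq, hT.calculus_mul_apply, hT.calculus_pow, hT.calculus_unitId]

theorem IsPositiveContraction.norm_semigroup_apply_le (hT : IsPositiveContraction T) {s : ℝ}
    (hs : 0 ≤ s) (y : H) : ‖semigroup T s y‖ ≤ ‖y‖ := by
  have := hT.norm_calculus_apply_le (expFun s) zero_le_one (fun x ↦ by
    rw [abs_of_nonneg (expFun_mem hs x).1]; exact (expFun_mem hs x).2) y
  rwa [one_mul] at this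

/-- Orbits starting in the dense range of `T` are Lipschitz; the rest is controlled by the uniform
bound 2 on differences of the semigroup. -/
theorem IsPositiveContraction.continuousOn_semigroup (hT : IsPositiveContraction T)
    (hd : DenseRange T) (y : H) : ContinuousOn (fun s ↦ semigroup T s y) (Ici 0) := by
  intro r hr
  rw [Metric.continuousWithinAt_iff]
  intro ε hε
  obtain ⟨z, hz⟩ := hd.exists_dist_lt y (by positivity : 0 < ε / 4)
  rw [dist_eq_norm] at hz
  refine ⟨ε / (2 * (‖z‖ + 1)), by positivity, fun s hs hsr ↦ ?_⟩
  have h1 : semigroup T s y - semigroup T r y =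
      calculus T (unitId * (expFun s - expFun r)) z +
        calculus T (expFun s - expFun r) (y - T z) := by
    rw [mul_comm, hT.calculus_mul_apply, hT.calculus_unitId, ← map_add, add_sub_cancel, map_sub]
    rfl
  have h2 := hT.norm_calculus_apply_le (unitId * (expFun s - expFun r)) (abs_nonneg (s - r))
    (abs_mul_expFun_sub_le hs hr) z
  have h3 := hT.norm_calculus_apply_le (expFun s - expFun r) zero_le_two (fun x ↦ by
    have h4 := expFun_mem hs x
    have h5 := expFun_mem hr x
    rw [ContinuousMap.sub_apply, abs_le]
    constructor <;> linarith [h4.1, h4.2, h5.1, h5.2]) (y - T z)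
  rw [Real.dist_eq, lt_div_iff₀ (by positivity)] at hsr
  rw [dist_eq_norm, h1]
  refine (norm_add_le _ _).trans_lt ?_
  nlinarith [abs_nonneg (s - r)]

theorem IsPositiveContraction.hasDerivWithinAt_semigroup (hT : IsPositiveContraction T)
    (hd : DenseRange T) (y : H) {r : ℝ} (hr : 0 ≤ r) :
    HasDerivWithinAt (fun s ↦ semigroup T s (T y))
      (-(semigroup T r y - T (semigroup T r y))) (Ici 0) r := by
  rw [hasDerivWithinAt_iff_isLittleO, Asymptotics.isLittleO_iff]
  intro c hc
  obtain ⟨z, hz⟩ := hd.exists_dist_lt y (by positivity : 0 < c / 4)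
  rw [dist_eq_norm] at hz
  filter_upwards [self_mem_nhdsWithin, mem_nhdsWithin_of_mem_nhds (Metric.ball_mem_nhds r
    (by positivity : 0 < c / (2 * (‖z‖ + 1))))] with s hs hsr
  -- `f` represents the first-order Taylor remainder. It is `O(s - r)` in sup norm and `O((s - r)²)`
  -- after one more factor `x`, so approximating `y` by `T z` yields `o(s - r)`.
  set f : C(Icc (0 : ℝ) 1, ℝ) :=
    unitId * (expFun s - expFun r) + (s - r) • ((1 - unitId) * expFun r)
  have hf (w : H) : calculus T f w = semigroup T s (T w) - semigroup T r (T w) -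
      (s - r) • -(semigroup T r w - T (semigroup T r w)) := by
    have h1 : calculus T (unitId * (expFun s - expFun r)) w =
        semigroup T s (T w) - semigroup T r (T w) := by
      rw [mul_comm, hT.calculus_mul_apply, hT.calculus_unitId, map_sub]; rfl
    have h2 : calculus T ((1 - unitId) * expFun r) w =
        semigroup T r w - T (semigroup T r w) := by
      rw [hT.calculus_mul_apply, hT.calculus_one_sub_unitId]; rfl
    rw [map_add, add_apply, h1, map_smul, smul_apply, h2, smul_neg, sub_neg_eq_add]
  have h1 : calculus T f y = calculus T (unitId * f) z + calculus T f (y - T z) := by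
    rw [mul_comm, hT.calculus_mul_apply, hT.calculus_unitId, ← map_add, add_sub_cancel]
  have h2 := hT.norm_calculus_apply_le (unitId * f) (sq_nonneg (s - r))
    (abs_expFun_taylor_le hs hr) z
  have h3 := hT.norm_calculus_apply_le f (by positivity : 0 ≤ |s - r| * 2) (fun x ↦ by
    have h4 := expFun_mem hr x
    have h5 : |(s - r) * ((1 - (x : ℝ)) * expFun r x)| ≤ |s - r| := by
      rw [abs_mul, abs_of_nonneg (mul_nonneg (sub_nonneg.2 x.2.2) h4.1)]
      exact mul_le_of_le_one_right (abs_nonneg _)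
        (mul_le_one₀ (by linarith [x.2.1]) h4.1 h4.2)
    refine (abs_add_le _ _).trans ?_
    have h6 := abs_mul_expFun_sub_le hs hr x
    rw [mul_two]
    exact add_le_add h6 h5) (y - T z)
  rw [Metric.mem_ball, Real.dist_eq, lt_div_iff₀ (by positivity)] at hsr
  rw [← hf, h1, Real.norm_eq_abs]
  refine (norm_add_le _ _).trans ?_
  rw [← sq_abs] at h2
  have h7 : |s - r| * ‖z‖ ≤ c / 2 := by nlinarith [abs_nonneg (s - r)]
  have h8 := mul_le_mul_of_nonneg_left h7 (abs_nonneg (s - r))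
  have h9 := mul_le_mul_of_nonneg_left hz.le (abs_nonneg (s - r))
  nlinarith

theorem IsPositiveContraction.contDiffOn_semigroup (hT : IsPositiveContraction T)
    (hd : DenseRange T) (y : H) : ContDiffOn ℝ 1 (fun s ↦ semigroup T s (T y)) (Ici 0) := by
  rw [contDiffOn_one_iff_derivWithin (uniqueDiffOn_Ici 0)]
  refine ⟨fun r hr ↦ (hT.hasDerivWithinAt_semigroup hd y hr).differentiableWithinAt, ?_⟩
  have hc := hT.continuousOn_semigroup hd y
  refine ContinuousOn.congr (hc.sub (T.continuous.comp_continuousOn hc)).neg fun r hr ↦ ?_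
  exact (hT.hasDerivWithinAt_semigroup hd y hr).derivWithin (uniqueDiffOn_Ici 0 r hr)

/-- With `e_s = exp (-s (1 - x) / x)`, the energy difference is the form at `y` of `(1 - x) (e_s +
e_r) · x (e_s - e_r)`, of size at most `2 |s - r|`. Starting from `T y ∈ D(A)` supplies the factor
`x`. -/
theorem IsPositiveContraction.abs_energy_sub_le (hT : IsPositiveContraction T) (y : H) {s r : ℝ}
    (hs : 0 ≤ s) (hr : 0 ≤ r) :
    |inner ℝ (semigroup T s y - T (semigroup T s y)) (T (semigroup T s y)) -
      inner ℝ (semigroup T r y - T (semigroup T r y)) (T (semigroup T r y))| ≤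
      2 * ‖y‖ ^ 2 * |s - r| := by
  have h (s : ℝ) : inner ℝ (semigroup T s y - T (semigroup T s y)) (T (semigroup T s y)) =
      inner ℝ y (calculus T (expFun s * ((1 - unitId) * (unitId * expFun s))) y) := by
    have h1 : semigroup T s y - T (semigroup T s y) =
        calculus T ((1 - unitId) * expFun s) y := by
      rw [hT.calculus_mul_apply, hT.calculus_one_sub_unitId]; rfl
    have h2 : T (semigroup T s y) = calculus T (unitId * expFun s) y := by
      rw [hT.calculus_mul_apply, hT.calculus_unitId]; rfl
    rw [h1, h2, hT.calculus_symm, ← hT.calculus_mul_apply]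
    congr 3
    ring
  rw [h, h, ← inner_sub_right, ← sub_apply, ← map_sub]
  refine (abs_real_inner_le_norm _ _).trans ?_
  have h1 := hT.norm_calculus_apply_le (expFun s * ((1 - unitId) * (unitId * expFun s)) -
    expFun r * ((1 - unitId) * (unitId * expFun r))) (by positivity : 0 ≤ 2 * |s - r|)
    (fun x ↦ by
      have hx0 : 0 ≤ 1 - (x : ℝ) := sub_nonneg.2 x.2.2
      have hx1 : 1 - (x : ℝ) ≤ 1 := sub_le_self _ x.2.1
      have h3 := expFun_mem hs x
      have h4 := expFun_mem hr x
      have h5 := abs_mul_expFun_sub_le hs hr x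
      have h6 : (expFun s * ((1 - unitId) * (unitId * expFun s)) -
          expFun r * ((1 - unitId) * (unitId * expFun r))) x =
          ((1 - x) * (expFun s x + expFun r x)) * (x * (expFun s x - expFun r x)) := by
        simp only [ContinuousMap.sub_apply, ContinuousMap.mul_apply, unitId_apply,
          ContinuousMap.one_apply]
        ring
      rw [h6, abs_mul, abs_of_nonneg (mul_nonneg hx0 (add_nonneg h3.1 h4.1))]
      refine mul_le_mul ?_ h5 (abs_nonneg _) zero_le_two
      nlinarith [h3.1, h3.2, h4.1, h4.2]) y
  nlinarith [norm_nonneg y]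

end Semigroup

/-! ### The scalar equation for the time change. -/

section ScalarODE

open scoped NNReal

/-- Boundedness of `F` confines solutions on `[-(n + 1), n + 1]` to the ball of radius `M (n + 1)`,
so Picard–Lindelöf applies at every length; uniqueness glues the pieces. -/
theorem exists_forall_hasDerivAt_of_lipschitz {F : ℝ → ℝ} {K : ℝ≥0} (hK : LipschitzWith K F)
    {M : ℝ≥0} (hM : ∀ x, |F x| ≤ M) :
    ∃ ψ : ℝ → ℝ, ψ 0 = 0 ∧ ∀ t, HasDerivAt ψ (F (ψ t)) t := by
  have hloc (n : ℕ) : ∃ ψ : ℝ → ℝ, ψ 0 = 0 ∧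
      ∀ t ∈ Ioo (-((n : ℝ) + 1)) (n + 1), HasDerivAt ψ (F (ψ t)) t := by
    have hn : (0 : ℝ) < n + 1 := by positivity
    have h : IsPicardLindelof (fun _ : ℝ ↦ F) (tmin := -((n : ℝ) + 1)) (tmax := n + 1)
        ⟨0, by constructor <;> linarith⟩ 0 (M * (n + 1)) 0 M K :=
      { lipschitzOnWith := fun _ _ ↦ hK.lipschitzOnWith
        continuousOn := fun _ _ ↦ continuousOn_const
        norm_le := fun _ _ x _ ↦ hM x
        mul_max_le := by simp }
    obtain ⟨ψ, h0, h1⟩ := h.exists_eq_forall_mem_Icc_hasDerivWithinAt₀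
    exact ⟨ψ, h0, fun t ht ↦ (h1 t (Ioo_subset_Icc_self ht)).hasDerivAt (Icc_mem_nhds ht.1 ht.2)⟩
  choose ψ h0 h1 using hloc
  have hmono {n k : ℕ} (hnk : n ≤ k) : EqOn (ψ n) (ψ k) (Ioo (-((n : ℝ) + 1)) (n + 1)) := by
    have hnk' : (n : ℝ) ≤ k := by exact_mod_cast hnk
    have hn : (0 : ℝ) < n + 1 := by positivity
    refine ODE_solution_unique_of_mem_Ioo (v := fun _ ↦ F) (s := fun _ ↦ univ) (K := K) (t₀ := 0)
      (fun t _ ↦ hK.lipschitzOnWith) ⟨by linarith, hn⟩ (fun t ht ↦ ⟨h1 n t ht, mem_univ _⟩)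
      (fun t ht ↦ ⟨h1 k t ⟨by linarith [ht.1], by linarith [ht.2]⟩, mem_univ _⟩) ?_
    rw [h0, h0]
  have heq {n k : ℕ} {t : ℝ} (hn : t ∈ Ioo (-((n : ℝ) + 1)) (n + 1))
      (hk : t ∈ Ioo (-((k : ℝ) + 1)) (k + 1)) : ψ n t = ψ k t := by
    rcases le_total n k with h | h
    · exact hmono h hn
    · exact (hmono h hk).symm
  have hmem (t : ℝ) : t ∈ Ioo (-((⌈|t|⌉₊ : ℝ) + 1)) (⌈|t|⌉₊ + 1) :=
    abs_lt.1 ((Nat.le_ceil |t|).trans_lt (lt_add_one _))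
  refine ⟨fun t ↦ ψ ⌈|t|⌉₊ t, h0 _, fun t ↦ ?_⟩
  refine (h1 _ t (hmem t)).congr_of_eventuallyEq ?_
  filter_upwards [Ioo_mem_nhds (hmem t).1 (hmem t).2] with s hs
  exact heq (hmem s) hs

/-- Separation of variables: `φ = ψ ∘ B` with `ψ' = F(ψ)` and `B' = 1 / b`. If `φ` vanished at some
`t > 0`, monotonicity would make it zero on `[0, t]`, against `φ'(0) = F(0) / b(0) > 0`. -/
theorem exists_global_time_change {F : ℝ → ℝ} {K : ℝ≥0} (hK : LipschitzWith K F)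
    {M : ℝ≥0} (hM : ∀ x, |F x| ≤ M) (hF : ∀ x, 0 ≤ F x) {b : ℝ → ℝ}
    (hb_cont : ContinuousOn b (Ici 0)) (hb_pos : ∀ t ∈ Ici (0 : ℝ), 0 < b t) :
    ∃ φ : ℝ → ℝ, φ 0 = 0 ∧ ContDiff ℝ 1 φ ∧ Monotone φ ∧
      (∀ t ∈ Ici (0 : ℝ), HasDerivAt φ (F (φ t) / b t) t) ∧
      (0 < F 0 → ∀ t, 0 < t → 0 < φ t) := by
  obtain ⟨ψ, hψ0, hψ⟩ := exists_forall_hasDerivAt_of_lipschitz hK hM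
  -- Freezing `b` at `b(0)` for negative times makes `φ` a `C¹` function on the whole line.
  set c : ℝ → ℝ := fun t ↦ (b (max t 0))⁻¹ with hc_def
  have hcpos (t : ℝ) : 0 < c t := inv_pos.2 (hb_pos _ (mem_Ici.2 (le_max_right _ _)))
  have hc : Continuous c := by
    refine Continuous.inv₀ ?_ fun t ↦ (hb_pos _ (mem_Ici.2 (le_max_right _ _))).ne'
    exact hb_cont.comp_continuous (by fun_prop) fun t ↦ mem_Ici.2 (le_max_right _ _)
  set B : ℝ → ℝ := fun t ↦ ∫ s in (0 : ℝ)..t, c s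
  have hB (t : ℝ) : HasDerivAt B (c t) t := hc.integral_hasStrictDerivAt 0 t |>.hasDerivAt
  have hB0 : B 0 = 0 := by simp [B]
  have hφ (t : ℝ) : HasDerivAt (ψ ∘ B) (F (ψ (B t)) * c t) t := (hψ (B t)).comp t (hB t)
  have hφd : Differentiable ℝ (ψ ∘ B) := fun t ↦ (hφ t).differentiableAt
  have hφderiv : deriv (ψ ∘ B) = fun t ↦ F ((ψ ∘ B) t) * c t := funext fun t ↦ (hφ t).deriv
  have hφ0 : (ψ ∘ B) 0 = 0 := by rw [Function.comp_apply, hB0, hψ0]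
  have hmono : Monotone (ψ ∘ B) := monotone_of_deriv_nonneg hφd fun t ↦ by
    rw [hφderiv]
    exact mul_nonneg (hF _) (hcpos t).le
  refine ⟨ψ ∘ B, hφ0, ?_, hmono, fun t ht ↦ ?_, fun h0 t ht ↦ ?_⟩
  · rw [contDiff_one_iff_deriv]
    refine ⟨hφd, ?_⟩
    rw [hφderiv]
    exact (hK.continuous.comp hφd.continuous).mul hc
  · have hct : c t = (b t)⁻¹ := by rw [hc_def]; simp only [max_eq_left (mem_Ici.1 ht)]
    rw [div_eq_mul_inv, ← hct]
    exact hφ t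
  · refine lt_of_le_of_ne (hφ0 ▸ hmono ht.le) fun hcon ↦ ?_
    have hconst : EqOn (ψ ∘ B) (fun _ ↦ 0) (Icc 0 t) := fun s hs ↦
      le_antisymm (hcon ▸ hmono hs.2) (hφ0 ▸ hmono hs.1)
    have h1 : HasDerivWithinAt (ψ ∘ B) 0 (Icc 0 t) 0 :=
      (hasDerivWithinAt_const 0 _ (0 : ℝ)).congr hconst (hconst ⟨le_rfl, ht.le⟩)
    have h2 := (uniqueDiffOn_Icc ht 0 ⟨le_rfl, ht.le⟩).eq_deriv _ h1 (hφ 0).hasDerivWithinAt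
    rw [hB0, hψ0] at h2
    exact (mul_pos h0 (hcpos 0)).ne h2

end ScalarODE

/-! ### Uniqueness by monotonicity and Gronwall. -/

section Uniqueness

variable {H : Type*} [NormedAddCommGroup H] [InnerProductSpace ℝ H] {A : H →ₗ.[ℝ] H}

theorem val_of_mem {x : H} (hx : x ∈ A.domain) : val A x = A ⟨x, hx⟩ := dif_pos hx

theorem inner_val_sub_nonneg (hA_nonneg : ∀ x : A.domain, 0 ≤ inner ℝ (A x) (x : H)) {x y : H}
    (hx : x ∈ A.domain) (hy : y ∈ A.domain) : 0 ≤ inner ℝ (val A x - val A y) (x - y) := by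
  have h := hA_nonneg (⟨x, hx⟩ - ⟨y, hy⟩)
  rwa [LinearPMap.map_sub, ← val_of_mem, ← val_of_mem] at h

theorem ContDiffInDomain.mem {k : ℕ} {S : Set ℝ} {u : ℝ → H} (h : ContDiffInDomain k A S u) {t : ℝ}
    (ht : t ∈ S) : u t ∈ A.domain := by
  obtain ⟨w, _, hw⟩ := h
  obtain ⟨y, hy, _⟩ := (LinearPMap.mem_graph_iff A).1 (w t).2
  exact hw t ht ▸ hy ▸ y.2

theorem ContDiffInDomain.continuousOn_val {k : ℕ} {S : Set ℝ} {u : ℝ → H}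
    (h : ContDiffInDomain k A S u) : ContinuousOn (fun t ↦ val A (u t)) S := by
  obtain ⟨w, hc, hw⟩ := h
  have h1 : ContinuousOn (fun t ↦ (w t : H × H).2) S :=
    (continuous_snd.comp continuous_subtype_val).comp_continuousOn hc.continuousOn
  refine h1.congr fun t ht ↦ ?_
  obtain ⟨y, hy, hy2⟩ := (LinearPMap.mem_graph_iff A).1 (w t).2
  simp only
  rw [← hw t ht, ← hy, val_of_mem y.2, ← hy2]

variable {b m : ℝ → ℝ} {u₀ : H}

theorem IsGlobalSolution.hasDerivWithinAt {u : ℝ → H} (hu : IsGlobalSolution A b m u₀ u)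
    (hb_pos : ∀ t ∈ Ici (0 : ℝ), 0 < b t) {t : ℝ} (ht : 0 ≤ t) :
    HasDerivWithinAt u (-((coeff A m (u t) / b t) • val A (u t))) (Ici 0) t := by
  have h1 := ((hu.contDiff.differentiableOn one_ne_zero) t ht).hasDerivWithinAt
  have h2 := hu.equation t ht
  have h3 := (hb_pos t ht).ne'
  convert h1 using 1
  rw [eq_comm, ← sub_eq_zero, sub_neg_eq_add]
  have h4 := congrArg ((b t)⁻¹ • ·) h2
  simp only [smul_add, smul_smul, inv_mul_cancel₀ h3, one_smul, smul_zero] at h4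
  rwa [div_eq_inv_mul]

/-- The term with `A x - A y` is discarded by monotonicity. By symmetry of `A` the energies differ
by at most `2 M ‖x - y‖`, so the coefficient difference contributes at most `K · 2M · M · M ‖x -
y‖²`; doubling gives `4 K M³`. -/
theorem inner_velocity_sub_le
    (hA_symm : ∀ x y : A.domain, inner ℝ (A x) (y : H) = inner ℝ (x : H) (A y))
    (hA_nonneg : ∀ x : A.domain, 0 ≤ inner ℝ (A x) (x : H)) {M K β : ℝ} (hK : 0 ≤ K)
    (hm_lip : ∀ σ ∈ Icc (0 : ℝ) (M * M), ∀ τ ∈ Icc (0 : ℝ) (M * M), |m σ - m τ| ≤ K * |σ - τ|)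
    (hm_nonneg : ∀ σ ∈ Ici (0 : ℝ), 0 ≤ m σ) (hβ : 0 < β) (hβM : β⁻¹ ≤ M)
    {x y : H} (hx : x ∈ A.domain) (hy : y ∈ A.domain) (hxM : ‖x‖ ≤ M) (hyM : ‖y‖ ≤ M)
    (hAx : ‖val A x‖ ≤ M) (hAy : ‖val A y‖ ≤ M) :
    2 * inner ℝ (x - y) (-((m (inner ℝ (val A x) x) / β) • val A x) -
      -((m (inner ℝ (val A y) y) / β) • val A y)) ≤ 4 * K * M ^ 3 * ‖x - y‖ ^ 2 := by
  have hM : 0 ≤ M := (norm_nonneg x).trans hxM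
  have hmem {z : H} (hz : z ∈ A.domain) (h1 : ‖z‖ ≤ M) (h2 : ‖val A z‖ ≤ M) :
      inner ℝ (val A z) z ∈ Icc (0 : ℝ) (M * M) := by
    refine ⟨?_, (real_inner_le_norm _ _).trans (mul_le_mul h2 h1 (norm_nonneg _) hM)⟩
    rw [val_of_mem hz]
    exact hA_nonneg ⟨z, hz⟩
  have hxm := hmem hx hxM hAx
  have hym := hmem hy hyM hAy
  have hmono := inner_val_sub_nonneg hA_nonneg hx hy
  have hdiff : |inner ℝ (val A x) x - inner ℝ (val A y) y| ≤ 2 * M * ‖x - y‖ := by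
    have h1 : inner ℝ (val A x) y = inner ℝ x (val A y) := by
      rw [val_of_mem hx, val_of_mem hy]
      exact hA_symm ⟨x, hx⟩ ⟨y, hy⟩
    have h2 : inner ℝ (val A x) x - inner ℝ (val A y) y =
        inner ℝ (val A x) (x - y) + inner ℝ (val A y) (x - y) := by
      rw [inner_sub_right, inner_sub_right, h1, real_inner_comm x (val A y)]
      ring
    rw [h2]
    refine (abs_add_le _ _).trans ?_
    have h3 := abs_real_inner_le_norm (val A x) (x - y)
    have h4 := abs_real_inner_le_norm (val A y) (x - y)
    nlinarith [norm_nonneg (x - y)]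
  have hmd := hm_lip _ hxm _ hym
  set p := m (inner ℝ (val A x) x)
  set q := m (inner ℝ (val A y) y)
  have hp : 0 ≤ p := hm_nonneg _ hxm.1
  have hsplit : inner ℝ (x - y) (-((p / β) • val A x) - -((q / β) • val A y)) =
      -(p / β) * inner ℝ (val A x - val A y) (x - y) +
        (q - p) / β * inner ℝ (val A y) (x - y) := by
    simp only [inner_sub_right, inner_neg_right, real_inner_smul_right, inner_sub_left,
      real_inner_comm (val A x), real_inner_comm (val A y)]
    ring
  have h5 : (q - p) / β * inner ℝ (val A y) (x - y) ≤
      (K * (2 * M * ‖x - y‖)) * M * (M * ‖x - y‖) := by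
    refine (le_abs_self _).trans ?_
    rw [abs_mul, div_eq_mul_inv, abs_mul, abs_of_pos (inv_pos.2 hβ), abs_sub_comm]
    have h6 := (abs_real_inner_le_norm (val A y) (x - y)).trans
      (mul_le_mul_of_nonneg_right hAy (norm_nonneg _))
    have h7 : |p - q| ≤ K * (2 * M * ‖x - y‖) := hmd.trans (by gcongr)
    gcongr
  have h8 : 0 ≤ p / β * inner ℝ (val A x - val A y) (x - y) :=
    mul_nonneg (div_nonneg hp hβ.le) hmono
  rw [hsplit]
  nlinarith

theorem IsGlobalSolution.eqOn
    (hA_symm : ∀ x y : A.domain, inner ℝ (A x) (y : H) = inner ℝ (x : H) (A y))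
    (hA_nonneg : ∀ x : A.domain, 0 ≤ inner ℝ (A x) (x : H))
    (hcoeff : ∀ x ∈ A.domain, coeff A m x = m (inner ℝ (val A x) x))
    (hb_cont : ContinuousOn b (Ici 0)) (hb_pos : ∀ t ∈ Ici (0 : ℝ), 0 < b t)
    (hm_lip : LocallyLipschitzOn (Ici 0) m) (hm_nonneg : ∀ σ ∈ Ici (0 : ℝ), 0 ≤ m σ)
    {u v : ℝ → H} (hu : IsGlobalSolution A b m u₀ u) (hv : IsGlobalSolution A b m u₀ v) :
    EqOn u v (Ici 0) := by
  intro N hN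
  have hsub : Icc 0 N ⊆ Ici (0 : ℝ) := Icc_subset_Ici_self
  have hbound {f : ℝ → H} (hf : ContinuousOn f (Ici 0)) : ∃ C, ∀ t ∈ Icc 0 N, ‖f t‖ ≤ C :=
    isCompact_Icc.exists_bound_of_continuousOn (hf.mono hsub)
  obtain ⟨C₁, h1⟩ := hbound hu.contDiff.continuousOn
  obtain ⟨C₂, h2⟩ := hbound hv.contDiff.continuousOn
  obtain ⟨C₃, h3⟩ := hbound hu.contDomain.continuousOn_val
  obtain ⟨C₄, h4⟩ := hbound hv.contDomain.continuousOn_val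
  obtain ⟨C₅, h5⟩ := isCompact_Icc.exists_bound_of_continuousOn (f := fun t ↦ (b t)⁻¹)
    ((hb_cont.mono hsub).inv₀ fun t ht ↦ (hb_pos t ht.1).ne')
  -- A single bound on `[0, N]` for `u`, `v`, `A u`, `A v` and `1 / b`.
  set M := max C₁ (max C₂ (max C₃ (max C₄ C₅)))
  obtain ⟨K, hK⟩ := (hm_lip.mono (Icc_subset_Ici_self : Icc 0 (M * M) ⊆ Ici 0)
    ).exists_lipschitzOnWith_of_compact isCompact_Icc
  have hm_lip' : ∀ σ ∈ Icc (0 : ℝ) (M * M), ∀ τ ∈ Icc (0 : ℝ) (M * M),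
      |m σ - m τ| ≤ K * |σ - τ| := fun σ hσ τ hτ ↦ hK.dist_le_mul σ hσ τ hτ
  have hd (t : ℝ) (ht : t ∈ Icc 0 N) : HasDerivWithinAt (fun t ↦ ‖u t - v t‖ ^ 2)
      (2 * inner ℝ (u t - v t) (-((coeff A m (u t) / b t) • val A (u t)) -
        -((coeff A m (v t) / b t) • val A (v t)))) (Ici 0) t :=
    ((hu.hasDerivWithinAt hb_pos ht.1).sub (hv.hasDerivWithinAt hb_pos ht.1)).norm_sq
  have hfin := le_gronwallBound_of_liminf_deriv_right_le (a := 0) (b := N) (δ := 0) (ε := 0)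
    (K := 4 * K * M ^ 3) (fun t ht ↦ (hd t ht).continuousWithinAt.mono hsub)
    (fun t ht r hr ↦ ((hd t ⟨ht.1, ht.2.le⟩).mono (Ici_subset_Ici.2 ht.1)).liminf_right_slope_le hr)
    (by rw [hu.initial, hv.initial, sub_self, norm_zero]; simp)
    (fun t ht ↦ by
      have ht' : t ∈ Icc 0 N := ⟨ht.1, ht.2.le⟩
      have hxu := hu.contDomain.mem ht.1
      have hxv := hv.contDomain.mem ht.1
      rw [add_zero, hcoeff _ hxu, hcoeff _ hxv]
      refine inner_velocity_sub_le hA_symm hA_nonneg K.2 hm_lip' hm_nonneg (hb_pos t ht.1)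
        ((le_abs_self _).trans ((h5 t ht').trans ?_)) hxu hxv ((h1 t ht').trans ?_)
        ((h2 t ht').trans ?_) ((h3 t ht').trans ?_) ((h4 t ht').trans ?_) <;> simp [M])
    N ⟨hN, le_rfl⟩
  rw [gronwallBound_ε0_δ0] at hfin
  have h0 : ‖u N - v N‖ = 0 := by
    have := le_antisymm hfin (sq_nonneg _)
    exact pow_eq_zero_iff two_ne_zero |>.1 this
  exact sub_eq_zero.1 (norm_eq_zero.1 h0)

end Uniqueness

/-! ### Regularity in the domains of the powers of `A`. -/

section Regularity

variable {H : Type*} [NormedAddCommGroup H] [InnerProductSpace ℝ H]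
  {A : H →ₗ.[ℝ] H}

theorem IsResolvent.contDiffInDomain_zero {T : H →L[ℝ] H} (hR : IsResolvent A T) {S : Set ℝ}
    {u z : ℝ → H} (hz : ContinuousOn z S) (hu : ∀ t ∈ S, u t = T (z t)) :
    ContDiffInDomain 0 A S u := by
  have hmem (y : H) : (T.prod (1 - T)) y ∈ A.graph :=
    (LinearPMap.mem_graph_iff A).2 ⟨⟨T y, hR.apply_mem y⟩, rfl, hR.map_apply y _⟩
  refine ⟨fun t ↦ (T.prod (1 - T)).codRestrict A.graph hmem (z t), ?_, fun t ht ↦ (hu t ht).symm⟩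
  rw [Nat.cast_zero, contDiffOn_zero]
  exact ((T.prod (1 - T)).codRestrict A.graph hmem).continuous.comp_continuousOn hz

variable [CompleteSpace H]

/-- Injectivity of `T ^ α` makes the local preimages `z` agree on overlaps, so they define one curve
in the graph. -/
theorem IsResolvent.contDiffInDomain_pow (hR : IsResolvent A (resolvent A))
    (hT : IsPositiveContraction (resolvent A)) {α : ℝ} (hα : 0 ≤ α) {S : Set ℝ} {u : ℝ → H} {k : ℕ}
    (h : ∀ t ∈ S, ∃ V : Set ℝ, IsOpen V ∧ t ∈ V ∧ ∃ z : ℝ → H, ContDiffOn ℝ k z (S ∩ V) ∧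
      ∀ s ∈ S ∩ V, u s = calculus (resolvent A) (rpowFun unitId hα) (z s)) :
    ContDiffInDomain k (pow A α) S u := by
  classical
  set P := calculus (resolvent A) (rpowFun unitId hα)
  set Q := calculus (resolvent A) (rpowFun (1 - unitId) hα)
  let L : H →L[ℝ] (pow A α).graph := (P.prod Q).codRestrict _ fun y ↦ hR.mem_graph_pow hT hα y
  let w : ℝ → (pow A α).graph := fun t ↦ if h : ∃ z, u t = P z then L h.choose else 0
  have hw {t : ℝ} {z : H} (htz : u t = P z) : w t = L z := by
    have h1 : ∃ z, u t = P z := ⟨z, htz⟩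
    simp only [w, dif_pos h1]
    rw [hT.rpow_injective hR.injective hα (h1.choose_spec.symm.trans htz)]
  refine ⟨w, contDiffOn_of_locally_contDiffOn fun t ht ↦ ?_, fun t ht ↦ ?_⟩
  · obtain ⟨V, hV, htV, z, hz, huz⟩ := h t ht
    exact ⟨V, hV, htV, (L.contDiff.comp_contDiffOn hz).congr fun s hs ↦ hw (huz s hs)⟩
  · obtain ⟨V, hV, htV, z, hz, huz⟩ := h t ht
    rw [hw (huz t ⟨ht, htV⟩)]
    exact (huz t ⟨ht, htV⟩).symm

/-- Near `t`, a fixed amount `φ (t / 2) > 0` of the semigroup is spent to gain `T ^ n = T ^ α T ^ (n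
- α)`; the remaining time `φ s - φ (t / 2) ≥ 0` carries the `C¹` dependence on `s`. -/
theorem IsResolvent.contDiffInDomain_pow_semigroup (hR : IsResolvent A (resolvent A))
    (hT : IsPositiveContraction (resolvent A)) (hd : DenseRange (resolvent A)) {α : ℝ}
    (hα : 0 ≤ α) (y : H) {φ : ℝ → ℝ} (hφ : ContDiff ℝ 1 φ) (hmono : Monotone φ)
    (hpos : ∀ t, 0 < t → 0 < φ t) :
    ContDiffInDomain 1 (pow A α) (Ioi 0)
      fun t ↦ semigroup (resolvent A) (φ t) (resolvent A y) := by
  refine hR.contDiffInDomain_pow hT hα fun t ht ↦ ⟨Ioi (t / 2), isOpen_Ioi, ?_, ?_⟩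
  · exact half_lt_self (mem_Ioi.1 ht)
  have hσ : 0 < φ (t / 2) := hpos _ (half_pos ht)
  obtain ⟨n, hn⟩ := exists_nat_ge α
  obtain ⟨R, hRn⟩ := hT.exists_pow_semigroup hσ n
  refine ⟨fun s ↦ calculus (resolvent A) (rpowFun unitId (sub_nonneg.2 hn))
    (R (semigroup (resolvent A) (φ s - φ (t / 2)) (resolvent A y))), ?_, fun s hs ↦ ?_⟩
  · refine (ContinuousLinearMap.contDiff _).comp_contDiffOn (R.contDiff.comp_contDiffOn ?_)
    exact (hT.contDiffOn_semigroup hd y).comp (hφ.sub contDiff_const).contDiffOn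
      fun s hs ↦ sub_nonneg.2 (hmono hs.2.le)
  · rw [← hT.pow_apply_eq hα (sub_nonneg.2 hn) n (by ring), ← hRn,
      ← hT.semigroup_add_apply hσ.le (sub_nonneg.2 (hmono (le_of_lt hs.2))), add_sub_cancel]

end Regularity

/-! ### Existence of the time change for the given data. -/

section Existence

variable {H : Type*} [NormedAddCommGroup H] [InnerProductSpace ℝ H]
  {A : H →ₗ.[ℝ] H} {b m : ℝ → ℝ}

theorem IsPositiveContraction.energy_mem {T : H →L[ℝ] H} (hT : IsPositiveContraction T)
    (hR : IsResolvent A T) (hA_nonneg : ∀ x : A.domain, 0 ≤ inner ℝ (A x) (x : H)) (z : H) :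
    inner ℝ (z - T z) (T z) ∈ Icc (0 : ℝ) (‖z‖ ^ 2) := by
  constructor
  · have := hA_nonneg ⟨T z, hR.apply_mem z⟩
    rwa [hR.map_apply] at this
  · have h1 := real_inner_self_nonneg (x := T z)
    have h2 := hT.le_one z
    rw [inner_sub_left, ← real_inner_self_eq_norm_sq, real_inner_comm]
    linarith

variable [CompleteSpace H]

theorem exists_time_change (hR : IsResolvent A (resolvent A))
    (hT : IsPositiveContraction (resolvent A))
    (hA_nonneg : ∀ x : A.domain, 0 ≤ inner ℝ (A x) (x : H))
    (hb_cont : ContinuousOn b (Ici 0)) (hb_pos : ∀ t ∈ Ici (0 : ℝ), 0 < b t)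
    (hm_lip : LocallyLipschitzOn (Ici 0) m) (hm_nonneg : ∀ σ ∈ Ici (0 : ℝ), 0 ≤ m σ) (y : H) :
    ∃ φ : ℝ → ℝ, φ 0 = 0 ∧ ContDiff ℝ 1 φ ∧ Monotone φ ∧
      (∀ t ∈ Ici (0 : ℝ), HasDerivAt φ
        (coeff A m (semigroup (resolvent A) (φ t) (resolvent A y)) / b t) t) ∧
      (coeff A m (resolvent A y) ≠ 0 → ∀ t, 0 < t → 0 < φ t) := by
  set T := resolvent A
  set G : ℝ → ℝ := fun s ↦
    inner ℝ (semigroup T s y - T (semigroup T s y)) (T (semigroup T s y))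
  -- Truncation at zero makes `F` bounded and Lipschitz on all of `ℝ`; it is invisible along `φ ≥
  -- 0`.
  set F : ℝ → ℝ := fun s ↦ m (G (max s 0))
  have hG (s : ℝ) : G (max s 0) ∈ Icc (0 : ℝ) (‖y‖ ^ 2) := by
    have h1 := hT.energy_mem hR hA_nonneg (semigroup T (max s 0) y)
    have h2 := hT.norm_semigroup_apply_le (le_max_right s 0) y
    exact ⟨h1.1, h1.2.trans (by gcongr)⟩
  obtain ⟨K, hK⟩ := (hm_lip.mono (Icc_subset_Ici_self : Icc 0 (‖y‖ ^ 2) ⊆ Ici 0)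
    ).exists_lipschitzOnWith_of_compact isCompact_Icc
  have hF_lip : LipschitzWith (K * (2 * ‖y‖₊ ^ 2)) F := by
    refine LipschitzWith.of_dist_le_mul fun s r ↦ ?_
    have h1 := hK.dist_le_mul _ (hG s) _ (hG r)
    have h2 := hT.abs_energy_sub_le y (le_max_right s 0) (le_max_right r 0)
    have h3 : |max s 0 - max r 0| ≤ |s - r| := abs_max_sub_max_le_abs s r 0
    refine h1.trans ?_
    rw [Real.dist_eq, Real.dist_eq]
    push_cast
    rw [mul_assoc]
    refine mul_le_mul_of_nonneg_left (h2.trans ?_) K.2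
    gcongr
  have hF_nonneg (s : ℝ) : 0 ≤ F s := hm_nonneg _ (hG s).1
  obtain ⟨C, hC⟩ := isCompact_Icc.exists_bound_of_continuousOn hK.continuousOn
  have hF_le (s : ℝ) : |F s| ≤ C.toNNReal := (hC _ (hG s)).trans (Real.le_coe_toNNReal C)
  have hcoeff {s : ℝ} (hs : 0 ≤ s) : coeff A m (semigroup T s (T y)) = F s := by
    rw [coeff, hT.semigroup_map, hR.sq_norm_val_pow_half hT (hR.apply_mem _), hR.val_apply]
    simp only [F, max_eq_left hs, G]
  obtain ⟨φ, h0, h1, h2, h3, h4⟩ := exists_global_time_change hF_lip hF_le hF_nonneg hb_cont hb_pos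
  refine ⟨φ, h0, h1, h2, fun t ht ↦ ?_, fun h ↦ h4 ((hF_nonneg 0).lt_of_ne ?_)⟩
  · rw [hcoeff (h0 ▸ h2 ht)]
    exact h3 t ht
  · rw [← hcoeff le_rfl, hT.semigroup_zero_apply]
    exact h.symm

end Existence

end Kirchhoff

/-! ### The theorem: assembly from the time change and the semigroup. -/

theorem theorem2p1 {H : Type*} [NormedAddCommGroup H] [InnerProductSpace ℝ H] [CompleteSpace H]
    (A : H →ₗ.[ℝ] H) (hA_dense : Dense (A.domain : Set H)) (hA_sa : IsSelfAdjoint A)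
    (hA_nonneg : ∀ x : A.domain, 0 ≤ inner ℝ (A x) (x : H))
    (b : ℝ → ℝ) (hb_cont : ContinuousOn b (Set.Ici 0)) (hb_pos : ∀ t ∈ Set.Ici (0 : ℝ), 0 < b t)
    (m : ℝ → ℝ) (hm_lip : LocallyLipschitzOn (Set.Ici 0) m)
    (hm_nonneg : ∀ σ ∈ Set.Ici (0 : ℝ), 0 ≤ m σ)
    (u₀ : H) (hu₀ : u₀ ∈ A.domain) :
    ∃ u : ℝ → H,
      Kirchhoff.IsGlobalSolution A b m u₀ u ∧
      (∀ v : ℝ → H, Kirchhoff.IsGlobalSolution A b m u₀ v → Set.EqOn v u (Set.Ici 0)) ∧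
      (Kirchhoff.coeff A m u₀ • Kirchhoff.val A u₀ ≠ 0 →
        derivWithin u (Set.Ici 0) 0 ≠ 0 ∧
        (∃ t ∈ Set.Ici (0 : ℝ), u t ≠ u₀) ∧
        ∀ α : ℝ, 0 ≤ α → Kirchhoff.ContDiffInDomain 1 (Kirchhoff.pow A α) (Set.Ioi 0) u) := by
  have hR := Kirchhoff.isResolvent_resolvent hA_sa hA_nonneg
  have hT := hR.isPositiveContraction hA_sa hA_nonneg
  have hd := hR.denseRange hA_dense
  -- Here `y = u₀ + A u₀`, so the initial datum is `T y` and the derivative of its orbit is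
  -- available down to time zero.
  obtain ⟨y, rfl⟩ := hR.exists_eq hu₀
  obtain ⟨φ, h0, hφ, hmono, hφ', hpos⟩ :=
    Kirchhoff.exists_time_change hR hT hA_nonneg hb_cont hb_pos hm_lip hm_nonneg y
  have hφ_nonneg {t : ℝ} (ht : t ∈ Ici (0 : ℝ)) : φ t ∈ Ici (0 : ℝ) := h0 ▸ hmono ht
  set T := Kirchhoff.resolvent A
  set u : ℝ → H := fun t ↦ Kirchhoff.semigroup T (φ t) (T y)
  have hu_zero : u 0 = T y := by simp only [u, h0, hT.semigroup_zero_apply]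
  have hval (t : ℝ) : Kirchhoff.val A (u t) =
      Kirchhoff.semigroup T (φ t) y - T (Kirchhoff.semigroup T (φ t) y) := by
    simp only [u, hT.semigroup_map, hR.val_apply]
  have hderiv {t : ℝ} (ht : t ∈ Ici (0 : ℝ)) : derivWithin u (Ici 0) t =
      (Kirchhoff.coeff A m (u t) / b t) • -Kirchhoff.val A (u t) := by
    rw [hval]
    exact ((hT.hasDerivWithinAt_semigroup hd y (hφ_nonneg ht)).scomp t
      (hφ' t ht).hasDerivWithinAt fun s hs ↦ hφ_nonneg hs).derivWithin (uniqueDiffOn_Ici 0 t ht)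
  have hu : Kirchhoff.IsGlobalSolution A b m (T y) u :=
    { contDiff := (hT.contDiffOn_semigroup hd y).comp hφ.contDiffOn fun t ht ↦ hφ_nonneg ht
      contDomain := hR.contDiffInDomain_zero
        (z := fun t ↦ Kirchhoff.semigroup T (φ t) y)
        ((hT.continuousOn_semigroup hd y).comp hφ.continuous.continuousOn
          fun t ht ↦ hφ_nonneg ht) fun t _ ↦ hT.semigroup_map _ y
      equation := fun t ht ↦ by
        rw [hderiv ht, smul_smul, mul_div_cancel₀ _ (hb_pos t ht).ne', smul_neg, neg_add_cancel]
      initial := hu_zero }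
  have hcoeff : ∀ x ∈ A.domain,
      Kirchhoff.coeff A m x = m (inner ℝ (Kirchhoff.val A x) x) := fun x hx ↦ by
    rw [Kirchhoff.coeff, hR.sq_norm_val_pow_half hT hx]
  refine ⟨u, hu, fun v hv ↦ hv.eqOn (Kirchhoff.isFormalAdjoint_self hA_sa) hA_nonneg hcoeff
    hb_cont hb_pos hm_lip hm_nonneg hu, fun hne ↦ ?_⟩
  have hne' : derivWithin u (Ici 0) 0 ≠ 0 := by
    rw [hderiv (mem_Ici.2 le_rfl), hu_zero, smul_neg, neg_ne_zero, div_eq_inv_mul, mul_smul]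
    exact smul_ne_zero (inv_ne_zero (hb_pos 0 (mem_Ici.2 le_rfl)).ne') hne
  refine ⟨hne', ?_, fun α hα ↦ hR.contDiffInDomain_pow_semigroup hT hd hα y hφ hmono
    (hpos (smul_ne_zero_iff.1 hne).1)⟩
  by_contra! hcon
  refine hne' ?_
  rw [derivWithin_congr (f := fun _ ↦ T y) hcon hu_zero, derivWithin_fun_const, Pi.zero_apply]
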